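/- Let $G$ be a finite simple connected graph. For a positive integer $k$, a \emph{locating rainbow $k$-coloring} of $G$ is a function $c:V(G)\to\{1,\dots,k\}$ (adjacent vertices may receive the same color) such that (i) for every two vertices $u,v$ there is a $u$–$v$ path whose internal vertices have pairwise different colors, and (ii) with $R_i=c^{-1}(i)$, the vectors $(d(v,R_1),\dots,d(v,R_k))$, $v\in V(G)$, are pairwise different, where $d(v,R)$ is the least distance from $v$ to a vertex of $R$ (and $d(v,\emptyset)=\infty$). Let $rvcl(G)$ denote the smallest positive integer $k$ for which $G$ has a locating rainbow $k$-coloring. For graphs $G$ and $H$, the edge corona $G\diamond H$ consists of one copy of $G$ and, for each edge $e$ of $G$, a separate copy $H_e$ of $H$, together with all edges joining the two end vertices of $e$ to every vertex of $H_e$. \textbf{Theorem.} Let $m\ge 3$ and $n\ge 2$ be integers, let $C_m$ be the cycle of order $m$ and $K_n$ the complete graph of order $n$. Then $$rvcl(C_m\diamond K_n)=\begin{cases} n+1, & \text{if } m=3,\text{ or } m\ge 4 \text{ and } n\ge m-1;\\ \max\{\lceil m/2\rceil+1,\ n+2\}, & \text{if } m\ge 4 \text{ and } \lceil m/2\rceil-1\le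 n<m-1;\\ \lceil m/2\rceil, & \text{if } m\ge 5 \text{ and } n\le \lceil m/2\rceil-2.\end{cases}$$ -/

import Mathlib

/-- Adjacency in the edge corona of `G` and `H`: the core `G` on the left summand, one copy of `H`
for every edge `e` of `G` on the right summand, and both ends of `e` joined to every vertex of the
copy of `H` that belongs to `e`. -/
def edgeCoronaAdj {V W : Type*} (G : SimpleGraph V) (H : SimpleGraph W) :
    V ⊕ (G.edgeSet × W) → V ⊕ (G.edgeSet × W) → Prop
  | Sum.inl u, Sum.inl v => G.Adj u v
  | Sum.inl u, Sum.inr p => u ∈ (p.1 : Sym2 V)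
  | Sum.inr p, Sum.inl u => u ∈ (p.1 : Sym2 V)
  | Sum.inr p, Sum.inr q => p.1 = q.1 ∧ H.Adj p.2 q.2

/-- The edge corona of two graphs. -/
def edgeCorona {V W : Type*} (G : SimpleGraph V) (H : SimpleGraph W) :
    SimpleGraph (V ⊕ (G.edgeSet × W)) where
  Adj := edgeCoronaAdj G H
  symm := ⟨by
    rintro (u | p) (v | q) h
    · exact G.adj_symm h
    · exact h
    · exact h
    · exact ⟨h.1.symm, H.adj_symm h.2⟩⟩
  loopless := ⟨by
    rintro (u | p) h
    · exact G.irrefl h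
    · exact H.irrefl h.2⟩

/-- A vertex colouring is a rainbow vertex colouring if every two vertices are joined by a path
whose internal vertices have pairwise different colours. The list `p.support.tail.dropLast`
consists of the internal vertices of the path `p`. -/
def IsRainbowVertexColoring {V C : Type*} (G : SimpleGraph V) (c : V → C) : Prop :=
  ∀ u v : V, ∃ p : G.Walk u v, p.IsPath ∧ (p.support.tail.dropLast.map c).Nodup

/-- The distance from a vertex to a set of vertices (the distance to the empty set is `⊤`). -/
noncomputable def distToSet {V : Type*} (G : SimpleGraph V) (v : V) (S : Set V) : ℕ∞ :=
  ⨅ w ∈ S, G.edist v w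

/-- The rainbow code of a vertex: its distances to the colour classes. -/
noncomputable def rainbowCode {V C : Type*} (G : SimpleGraph V) (c : V → C) (v : V) : C → ℕ∞ :=
  fun i => distToSet G v {w | c w = i}

/-- A locating rainbow colouring: a rainbow vertex colouring for which different vertices have
different rainbow codes. -/
def IsLocatingRainbowColoring {V C : Type*} (G : SimpleGraph V) (c : V → C) : Prop :=
  IsRainbowVertexColoring G c ∧ Function.Injective (rainbowCode G c)

/-- The locating rainbow connection number: the least positive `k` such that there is a locating
rainbow colouring with `k` colours. -/
noncomputable def rvcl {V : Type*} (G : SimpleGraph V) : ℕ :=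
  sInf {k : ℕ | 0 < k ∧ ∃ c : V → Fin k, IsLocatingRainbowColoring G c}

/-! Lower bounds. Vertices of one copy of K_n (a clique) are twins, so their colours differ. With
only n colours every clique would show all of them, and equally coloured vertices of different
cliques would share a code; hence k ≥ n + 1 (`add_one_le_of_locating`). With exactly n + 1 colours
each clique misses one colour. Locating forces this colour to change at every step around the cycle;
then every core vertex sees all colours, so the core colours are distinct and m ≤ n + 1
(`le_of_locating_add_one`). Independently, a path between two cliques runs through a whole arc of
the core, so one of any two complementary arcs has distinct colours; counting gives m ≤ 2k for m ≥ 5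
(`le_two_mul_of_rainbow`).

Upper bounds. Core vertex i gets the colour i mod k, which is rainbow for m ≤ 2k. Codes are
separated by a vertex's own colour and the set of colours it sees (`exists_locating_coloring`). If m
≤ n + 1, clique i misses the colour i + 2, cyclically. Otherwise clique i < k gets the cyclic window
i, …, i + n - 1. A clique i ≥ k sees the window of length n + 1 from i - k but omits its second
colour, which an end supplies. A core vertex seeing the same window has exactly the omitted colour,
so no clash arises. Cliques near the seam of the cycle need modified sets. -/

/-- The colour `i` occurs in the closed neighbourhood of `v`. -/
def SeesColor {V C : Type*} (G : SimpleGraph V) (c : V → C) (v : V) (i : C) : Prop :=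
  ∃ w, (v = w ∨ G.Adj v w) ∧ c w = i

/-! ### Rainbow codes, seen colours and twins -/

section Distance

variable {V C : Type*} {G : SimpleGraph V} {c : V → C}

theorem distToSet_le_coe_iff {v : V} {S : Set V} {d : ℕ} :
    distToSet G v S ≤ d ↔ ∃ w ∈ S, G.edist v w ≤ d := by
  -- A strict bound on an infimum is witnessed by one of its terms, a weak bound need not be.
  rw [← ENat.lt_natCast_add_one_iff, distToSet]
  simp only [iInf_lt_iff, ENat.lt_natCast_add_one_iff, exists_prop]

theorem rainbowCode_le_coe_iff {v : V} {i : C} {d : ℕ} :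
    rainbowCode G c v i ≤ d ↔ ∃ w, c w = i ∧ G.edist v w ≤ d :=
  distToSet_le_coe_iff

theorem rainbowCode_eq_zero_iff {v : V} {i : C} : rainbowCode G c v i = 0 ↔ c v = i := by
  have h := rainbowCode_le_coe_iff (G := G) (c := c) (v := v) (i := i) (d := 0)
  simp only [Nat.cast_zero, nonpos_iff_eq_zero, SimpleGraph.edist_eq_zero_iff] at h
  rw [h]
  constructor
  · rintro ⟨w, hw, rfl⟩
    exact hw
  · exact fun h => ⟨v, h, rfl⟩

theorem rainbowCode_le_one_iff {v : V} {i : C} :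
    rainbowCode G c v i ≤ 1 ↔ SeesColor G c v i := by
  have h := rainbowCode_le_coe_iff (G := G) (c := c) (v := v) (i := i) (d := 1)
  simp only [Nat.cast_one, SimpleGraph.edist_le_one_iff_adj_or_eq] at h
  rw [h]
  constructor
  · rintro ⟨w, hw, h⟩
    exact ⟨w, h.symm, hw⟩
  · rintro ⟨w, h, hw⟩
    exact ⟨w, hw, h.symm⟩

theorem rainbowCode_eq_one_iff {v : V} {i : C} :
    rainbowCode G c v i = 1 ↔ c v ≠ i ∧ SeesColor G c v i := by
  rw [← rainbowCode_le_one_iff, ne_eq, ← rainbowCode_eq_zero_iff (G := G), ← ne_eq,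
    ← Order.one_le_iff_ne_zero, le_antisymm_iff, and_comm]

theorem rainbowCode_le_two {v w z : V} (h₁ : G.Adj v w) (h₂ : G.Adj w z) :
    rainbowCode G c v (c z) ≤ 2 :=
  rainbowCode_le_coe_iff.2
    ⟨z, rfl, by simpa using SimpleGraph.edist_le (.cons h₁ (.cons h₂ .nil))⟩

theorem rainbowCode_eq_two {v w z : V} (h₁ : G.Adj v w) (h₂ : G.Adj w z)
    (h : ¬ SeesColor G c v (c z)) : rainbowCode G c v (c z) = 2 := by
  refine le_antisymm (rainbowCode_le_two h₁ h₂) ?_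
  rw [← rainbowCode_le_one_iff, not_le] at h
  exact (ENat.add_one_le_iff (by simp)).2 h

/-- A vertex whose neighbourhood lies in the closed neighbourhood of `y` is not closer than `y` to
a set which does not contain it. -/
theorem distToSet_le_of_adj_imp {x y : V} {S : Set V} (hx : x ∉ S)
    (h : ∀ z, G.Adj x z → y = z ∨ G.Adj y z) : distToSet G y S ≤ distToSet G x S := by
  refine le_iInf₂ fun w hw => (iInf₂_le w hw).trans ?_
  by_cases htop : G.edist x w = ⊤
  · simp [htop]
  obtain ⟨p, hp⟩ := SimpleGraph.exists_walk_of_edist_ne_top htop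
  rw [← hp]
  cases p with
  | nil => exact absurd hw hx
  | @cons _ z _ hxz q =>
    rcases h z hxz with rfl | hyz
    · exact (SimpleGraph.edist_le q).trans (by simp)
    · exact (SimpleGraph.edist_le (.cons hyz q)).trans (by simp)

theorem rainbowCode_eq_of_twins {x y : V} (hx : ∀ z, G.Adj x z → y = z ∨ G.Adj y z)
    (hy : ∀ z, G.Adj y z → x = z ∨ G.Adj x z) {i : C} (hxi : c x ≠ i) (hyi : c y ≠ i) :
    rainbowCode G c x i = rainbowCode G c y i :=
  le_antisymm (distToSet_le_of_adj_imp hyi hy) (distToSet_le_of_adj_imp hxi hx)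

theorem IsLocatingRainbowColoring.color_ne_of_twins (hc : IsLocatingRainbowColoring G c) {x y : V}
    (hx : ∀ z, G.Adj x z → y = z ∨ G.Adj y z) (hy : ∀ z, G.Adj y z → x = z ∨ G.Adj x z)
    (hne : x ≠ y) : c x ≠ c y := by
  intro hxy
  refine hne (hc.2 (funext fun i => ?_))
  by_cases hi : c x = i
  · rw [rainbowCode_eq_zero_iff.2 hi, rainbowCode_eq_zero_iff.2 (hxy ▸ hi)]
  · exact rainbowCode_eq_of_twins hx hy hi (hxy ▸ hi)

/-- Vertices of the same colour which see all colours but possibly `a`, and have the same distance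
to the colour `a`, are equal. -/
theorem IsLocatingRainbowColoring.eq_of_sees_ne (hc : IsLocatingRainbowColoring G c) {x y : V}
    {a : C} (hxy : c x = c y) (hx : ∀ i ≠ a, SeesColor G c x i) (hy : ∀ i ≠ a, SeesColor G c y i)
    (ha : rainbowCode G c x a = rainbowCode G c y a) : x = y := by
  refine hc.2 (funext fun i => ?_)
  by_cases hia : i = a
  · rw [hia, ha]
  by_cases hi : c x = i
  · rw [rainbowCode_eq_zero_iff.2 hi, rainbowCode_eq_zero_iff.2 (hxy ▸ hi)]
  · rw [rainbowCode_eq_one_iff.2 ⟨hi, hx i hia⟩, rainbowCode_eq_one_iff.2 ⟨hxy ▸ hi, hy i hia⟩]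

/-- Vertices of the same colour which see all colours are equal. -/
theorem IsLocatingRainbowColoring.eq_of_sees (hc : IsLocatingRainbowColoring G c) {x y : V}
    (hxy : c x = c y) (hx : ∀ i, SeesColor G c x i) (hy : ∀ i, SeesColor G c y i) : x = y :=
  hc.eq_of_sees_ne (a := c x) hxy (fun i _ => hx i) (fun i _ => hy i) <| by
    rw [rainbowCode_eq_zero_iff.2 rfl, rainbowCode_eq_zero_iff.2 hxy.symm]

/-- A colouring is locating if vertices of the same colour see different sets of colours. -/
theorem rainbowCode_injective_of_sees
    (h : ∀ x y, c x = c y → (∀ i, SeesColor G c x i ↔ SeesColor G c y i) → x = y) :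
    Function.Injective (rainbowCode G c) := by
  intro x y hxy
  refine h x y ?_ fun i => ?_
  · exact (rainbowCode_eq_zero_iff.1 (hxy ▸ rainbowCode_eq_zero_iff.2 rfl)).symm
  · rw [← rainbowCode_le_one_iff, ← rainbowCode_le_one_iff, hxy]

/-- To connect two vertices by a rainbow path it is enough to connect them by a walk such that the
vertices it runs through, other than its ends, have different colours. -/
theorem exists_rainbow_path {u v : V} {S : Set V} (hS : Set.InjOn c S) (p : G.Walk u v)
    (hp : ∀ w ∈ p.support, w = u ∨ w = v ∨ w ∈ S) :
    ∃ q : G.Walk u v, q.IsPath ∧ (q.support.tail.dropLast.map c).Nodup := by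
  classical
  refine ⟨p.bypass, p.bypass_isPath, ?_⟩
  have hsub : ∀ w ∈ p.bypass.support, w = u ∨ w = v ∨ w ∈ S := fun w hw =>
    hp w (p.support_bypass_subset_support hw)
  have hnd := p.bypass_isPath.support_nodup
  generalize p.bypass = q at hsub hnd
  have htail : q.support.tail.Nodup := hnd.tail
  refine List.Nodup.map_on ?_ (htail.sublist (List.dropLast_sublist _))
  have key : ∀ w ∈ q.support.tail.dropLast, w ∈ S := by
    intro w hw
    have hw' : w ∈ q.support.tail := List.dropLast_subset _ hw
    have hwu : w ≠ u := by
      rintro rfl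
      rw [← q.cons_tail_support] at hnd
      exact (List.nodup_cons.1 hnd).1 hw'
    have hwv : w ≠ v := by
      rintro rfl
      have hne : q.support.tail ≠ [] := List.ne_nil_of_mem hw'
      have hlast : q.support.tail.getLast hne = w := by
        rw [List.getLast_tail, q.getLast_support]
      rw [← List.dropLast_append_getLast hne, hlast] at htail
      exact (List.nodup_append.1 htail).2.2 w hw w (by simp) rfl
    have := hsub w (List.mem_of_mem_tail hw')
    tauto
  exact fun x hx y hy hxy => hS (key x hx) (key y hy) hxy

end Distance

/-! ### Invariance under graph isomorphism -/

section Iso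

variable {V W C : Type*} {G : SimpleGraph V} {H : SimpleGraph W}

theorem edist_map_le (f : G →g H) (u v : V) : H.edist (f u) (f v) ≤ G.edist u v := by
  by_cases h : G.edist u v = ⊤
  · simp [h]
  obtain ⟨p, hp⟩ := SimpleGraph.exists_walk_of_edist_ne_top h
  rw [← hp, ← p.length_map f]
  exact SimpleGraph.edist_le _

theorem edist_iso (f : G ≃g H) (u v : V) : H.edist (f u) (f v) = G.edist u v := by
  refine le_antisymm (edist_map_le f.toHom u v) ?_
  simpa using edist_map_le f.symm.toHom (f u) (f v)

theorem rainbowCode_iso (f : G ≃g H) (c : W → C) (v : V) :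
    rainbowCode G (c ∘ f) v = rainbowCode H c (f v) := by
  funext i
  simp only [rainbowCode, distToSet, Set.mem_ofPred_eq, Function.comp_apply]
  rw [← f.toEquiv.iInf_comp]
  simp [edist_iso]

theorem IsLocatingRainbowColoring.comp_iso {c : W → C} (hc : IsLocatingRainbowColoring H c)
    (f : G ≃g H) : IsLocatingRainbowColoring G (c ∘ f) := by
  constructor
  · intro u v
    obtain ⟨p, hp, hpc⟩ := hc.1 (f u) (f v)
    refine ⟨(p.map f.symm.toHom).copy (by simp) (by simp), ?_, ?_⟩
    · rw [SimpleGraph.Walk.isPath_copy]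
      exact hp.map f.symm.injective
    · rw [SimpleGraph.Walk.support_copy, SimpleGraph.Walk.support_map, ← List.map_tail,
        ← List.map_dropLast, List.map_map]
      convert hpc using 2
      funext w
      simp
  · intro u v huv
    rw [rainbowCode_iso, rainbowCode_iso] at huv
    exact f.injective (hc.2 huv)

theorem rvcl_congr (f : G ≃g H) : rvcl G = rvcl H := by
  unfold rvcl
  congr 1
  ext k
  refine and_congr_right fun _ => ⟨?_, ?_⟩
  · rintro ⟨c, hc⟩
    exact ⟨_, hc.comp_iso f.symm⟩
  · rintro ⟨c, hc⟩
    exact ⟨_, hc.comp_iso f⟩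

end Iso

theorem rvcl_eq_of {V : Type*} {G : SimpleGraph V} {k : ℕ} (hk : 0 < k)
    (h : ∃ c : V → Fin k, IsLocatingRainbowColoring G c)
    (hmin : ∀ (l : ℕ) (c : V → Fin l), IsLocatingRainbowColoring G c → k ≤ l) : rvcl G = k :=
  le_antisymm (Nat.sInf_le ⟨hk, h⟩) <|
    le_csInf ⟨k, hk, h⟩ fun l ⟨_, c, hc⟩ => hmin l c hc

/-! ### A concrete model of the edge corona -/

/-- The relation that generates the adjacency of `cycleCorona`. -/
def cycleCoronaRel (m n : ℕ) [NeZero m] :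
    Fin m ⊕ (Fin m × Fin n) → Fin m ⊕ (Fin m × Fin n) → Prop
  | Sum.inl i, Sum.inl j => j = i + 1
  | Sum.inl i, Sum.inr p => i = p.1 ∨ i = p.1 + 1
  | Sum.inr _, Sum.inl _ => False
  | Sum.inr p, Sum.inr q => p.1 = q.1

/-- The edge corona of a cycle and a complete graph, with the edge `{i, i + 1}` of the cycle
represented by `i`. -/
def cycleCorona (m n : ℕ) [NeZero m] : SimpleGraph (Fin m ⊕ (Fin m × Fin n)) :=
  SimpleGraph.fromRel (cycleCoronaRel m n)

section Model

variable {m n : ℕ} [NeZero m]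

theorem val_add_one_fin (hm : 2 ≤ m) (i : Fin m) :
    (i + 1).val = if i.val + 1 = m then 0 else i.val + 1 := by
  have := i.2
  rw [Fin.val_add, Fin.val_one', Nat.mod_eq_of_lt (show 1 < m by omega)]
  split_ifs with h
  · rw [h, Nat.mod_self]
  · exact Nat.mod_eq_of_lt (by omega)

theorem fin_add_one_ne (hm : 2 ≤ m) (i : Fin m) : i + 1 ≠ i := by
  intro h
  have := val_add_one_fin hm i
  rw [h] at this
  split_ifs at this <;> omega

theorem fin_add_two_ne (hm : 3 ≤ m) (i : Fin m) : i + 1 + 1 ≠ i := by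
  intro h
  have h₁ := val_add_one_fin (by omega) i
  have h₂ := val_add_one_fin (by omega) (i + 1)
  rw [h, h₁] at h₂
  split_ifs at h₂ <;> omega

theorem cycleGraph_adj_iff (hm : 2 ≤ m) (i j : Fin m) :
    (SimpleGraph.cycleGraph m).Adj i j ↔ j = i + 1 ∨ i = j + 1 := by
  obtain ⟨k, rfl⟩ := Nat.exists_eq_add_of_le' hm
  rw [SimpleGraph.cycleGraph_adj, sub_eq_iff_eq_add', sub_eq_iff_eq_add', or_comm, add_comm i,
    add_comm j]

theorem cycleCorona_adj_core (hm : 2 ≤ m) (i j : Fin m) :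
    (cycleCorona m n).Adj (Sum.inl i) (Sum.inl j) ↔ j = i + 1 ∨ i = j + 1 := by
  simp only [cycleCorona, SimpleGraph.fromRel_adj, cycleCoronaRel, ne_eq, Sum.inl.injEq,
    and_iff_right_iff_imp]
  rintro (rfl | rfl)
  · exact (fin_add_one_ne hm i).symm
  · exact fin_add_one_ne hm j

theorem cycleCorona_adj_core_clique (i : Fin m) (p : Fin m × Fin n) :
    (cycleCorona m n).Adj (Sum.inl i) (Sum.inr p) ↔ i = p.1 ∨ i = p.1 + 1 := by
  simp [cycleCorona, cycleCoronaRel]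

theorem cycleCorona_adj_clique_core (i : Fin m) (p : Fin m × Fin n) :
    (cycleCorona m n).Adj (Sum.inr p) (Sum.inl i) ↔ i = p.1 ∨ i = p.1 + 1 := by
  rw [SimpleGraph.adj_comm, cycleCorona_adj_core_clique]

theorem cycleCorona_adj_clique (p q : Fin m × Fin n) :
    (cycleCorona m n).Adj (Sum.inr p) (Sum.inr q) ↔ p ≠ q ∧ p.1 = q.1 := by
  simp [cycleCorona, cycleCoronaRel, eq_comm]

theorem exists_cycleGraph_edge_equiv (hm : 3 ≤ m) :
    ∃ f : Fin m ≃ (SimpleGraph.cycleGraph m).edgeSet, ∀ i, (f i : Sym2 (Fin m)) = s(i, i + 1) := by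
  refine ⟨Equiv.ofBijective (fun i => ⟨s(i, i + 1), ?_⟩) ⟨?_, ?_⟩, fun i => rfl⟩
  · rw [SimpleGraph.mem_edgeSet, cycleGraph_adj_iff (by omega)]
    exact Or.inl rfl
  · intro i j hij
    simp only [Subtype.mk.injEq, Sym2.eq_iff] at hij
    rcases hij with h | ⟨h₁, h₂⟩
    · exact h.1
    · rw [h₁] at h₂
      exact absurd h₂ (fin_add_two_ne hm j)
  · rintro ⟨e, he⟩
    induction e with | _ i j =>
    rw [SimpleGraph.mem_edgeSet, cycleGraph_adj_iff (by omega)] at he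
    rcases he with rfl | rfl
    · exact ⟨i, rfl⟩
    · exact ⟨j, Subtype.ext Sym2.eq_swap⟩

theorem exists_iso_cycleCorona (hm : 3 ≤ m) : Nonempty (cycleCorona m n ≃g
    edgeCorona (SimpleGraph.cycleGraph m) (SimpleGraph.completeGraph (Fin n))) := by
  obtain ⟨f, hf⟩ := exists_cycleGraph_edge_equiv hm
  refine ⟨⟨(Equiv.refl _).sumCongr (f.prodCongr (Equiv.refl _)), ?_⟩⟩
  rintro (i | p) (j | q)
  · rw [cycleCorona_adj_core (by omega), ← cycleGraph_adj_iff (by omega)]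
    rfl
  · rw [cycleCorona_adj_core_clique, ← Sym2.mem_iff, ← hf]
    rfl
  · rw [cycleCorona_adj_clique_core, ← Sym2.mem_iff, ← hf]
    rfl
  · rw [cycleCorona_adj_clique]
    change f p.1 = f q.1 ∧ (SimpleGraph.completeGraph (Fin n)).Adj p.2 q.2 ↔ _
    rw [f.injective.eq_iff, SimpleGraph.top_adj, ne_eq, ne_eq, Prod.ext_iff]
    tauto

theorem sees_clique_iff {C : Type*} (c : Fin m ⊕ (Fin m × Fin n) → C) (i : Fin m) (s : Fin n)
    (a : C) : SeesColor (cycleCorona m n) c (Sum.inr (i, s)) a ↔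
      c (Sum.inl i) = a ∨ c (Sum.inl (i + 1)) = a ∨ ∃ t, c (Sum.inr (i, t)) = a := by
  constructor
  · rintro ⟨j | ⟨j, t⟩, h, rfl⟩
    · rw [cycleCorona_adj_clique_core] at h
      rcases h with h | rfl | rfl
      · cases h
      · exact Or.inl rfl
      · exact Or.inr (Or.inl rfl)
    · rw [cycleCorona_adj_clique] at h
      have : i = j := by
        rcases h with h | h
        · simp only [Sum.inr.injEq, Prod.mk.injEq] at h
          exact h.1
        · exact h.2
      exact Or.inr (Or.inr ⟨t, by rw [this]⟩)
  · rintro (rfl | rfl | ⟨t, rfl⟩)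
    · exact ⟨_, Or.inr ((cycleCorona_adj_clique_core _ _).2 (Or.inl rfl)), rfl⟩
    · exact ⟨_, Or.inr ((cycleCorona_adj_clique_core _ _).2 (Or.inr rfl)), rfl⟩
    · by_cases hst : s = t
      · exact ⟨_, Or.inl rfl, by rw [hst]⟩
      · exact ⟨Sum.inr (i, t), Or.inr ((cycleCorona_adj_clique _ _).2 ⟨by simp [hst], rfl⟩), rfl⟩

theorem sees_core_iff {C : Type*} (hm : 2 ≤ m) (c : Fin m ⊕ (Fin m × Fin n) → C) (i : Fin m)
    (a : C) : SeesColor (cycleCorona m n) c (Sum.inl (i + 1)) a ↔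
      c (Sum.inl i) = a ∨ c (Sum.inl (i + 1)) = a ∨ c (Sum.inl (i + 1 + 1)) = a ∨
        (∃ t, c (Sum.inr (i, t)) = a) ∨ ∃ t, c (Sum.inr (i + 1, t)) = a := by
  constructor
  · rintro ⟨j | ⟨j, t⟩, h, rfl⟩
    · rw [cycleCorona_adj_core hm] at h
      rcases h with h | rfl | h
      · cases h
        simp
      · simp
      · rw [add_left_inj] at h
        simp [h]
    · rw [cycleCorona_adj_core_clique] at h
      rcases h with h | rfl | h
      · cases h
      · exact Or.inr (Or.inr (Or.inr (Or.inr ⟨t, rfl⟩)))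
      · rw [add_left_inj] at h
        exact Or.inr (Or.inr (Or.inr (Or.inl ⟨t, by rw [h]⟩)))
  · rintro (rfl | rfl | rfl | ⟨t, rfl⟩ | ⟨t, rfl⟩)
    · exact ⟨_, Or.inr ((cycleCorona_adj_core hm _ _).2 (Or.inr rfl)), rfl⟩
    · exact ⟨_, Or.inl rfl, rfl⟩
    · exact ⟨_, Or.inr ((cycleCorona_adj_core hm _ _).2 (Or.inl rfl)), rfl⟩
    · exact ⟨_, Or.inr ((cycleCorona_adj_core_clique _ _).2 (Or.inr rfl)), rfl⟩
    · exact ⟨_, Or.inr ((cycleCorona_adj_core_clique _ _).2 (Or.inl rfl)), rfl⟩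

/-- Vertices of one clique see each other and the same neighbours outside of the clique. -/
theorem cycleCorona_twins (i : Fin m) (s t : Fin n) (z : Fin m ⊕ (Fin m × Fin n))
    (h : (cycleCorona m n).Adj (Sum.inr (i, s)) z) :
    Sum.inr (i, t) = z ∨ (cycleCorona m n).Adj (Sum.inr (i, t)) z := by
  rcases z with j | ⟨j, u⟩
  · rw [cycleCorona_adj_clique_core] at h ⊢
    exact Or.inr h
  · rw [cycleCorona_adj_clique] at h ⊢
    have h' : i = j := h.2
    by_cases htu : t = u
    · exact Or.inl (by rw [h', htu])
    · exact Or.inr ⟨by simp [htu], h'⟩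

end Model

/-! ### Lower bounds from the locating condition -/

section LocatingLowerBound

variable {m n k : ℕ} [NeZero m]

theorem clique_color_injective {C : Type*} {c : Fin m ⊕ (Fin m × Fin n) → C}
    (hc : IsLocatingRainbowColoring (cycleCorona m n) c) (i : Fin m) :
    Function.Injective fun t => c (Sum.inr (i, t)) := by
  intro s t hst
  by_contra hne
  exact hc.color_ne_of_twins (cycleCorona_twins i s t) (cycleCorona_twins i t s)
    (by simp [hne]) hst

theorem add_one_le_of_locating (hm : 3 ≤ m) (hn : 1 ≤ n) {c : Fin m ⊕ (Fin m × Fin n) → Fin k}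
    (hc : IsLocatingRainbowColoring (cycleCorona m n) c) : n + 1 ≤ k := by
  have hinj := clique_color_injective hc
  have hnk : n ≤ k := by simpa using Fintype.card_le_of_injective _ (hinj 0)
  rcases hnk.lt_or_eq with h | rfl
  · exact h
  have hsurj : ∀ i a, ∃ t, c (Sum.inr (i, t)) = a := fun i =>
    Finite.surjective_of_injective (hinj i)
  have hsees : ∀ p a, SeesColor (cycleCorona m n) c (Sum.inr p) a := fun p a =>
    (sees_clique_iff c p.1 p.2 a).2 (Or.inr (Or.inr (hsurj p.1 a)))
  obtain ⟨t, ht⟩ := hsurj (0 + 1) (c (Sum.inr (0, ⟨0, hn⟩)))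
  have h := hc.eq_of_sees ht (hsees _) (hsees _)
  simp only [Sum.inr.injEq, Prod.mk.injEq] at h
  exact absurd h.1 (fin_add_one_ne (by omega) 0)

/-- An injective map into a type with one more element misses exactly one value. -/
theorem exists_missing_value {f : Fin n → Fin (n + 1)} (hf : Function.Injective f) :
    ∃ a, ∀ b, (∃ t, f t = b) ↔ b ≠ a := by
  have hcard : (Finset.univ.image f)ᶜ.card = 1 := by
    rw [Finset.card_compl, Finset.card_image_of_injective _ hf]
    simp
  obtain ⟨a, ha⟩ := Finset.card_eq_one.1 hcard
  refine ⟨a, fun b => ?_⟩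
  have := Finset.ext_iff.1 ha b
  simp only [Finset.mem_compl, Finset.mem_image, Finset.mem_univ, true_and,
    Finset.mem_singleton] at this
  rw [ne_eq, ← this, not_not]

/-- A cyclic sequence which does not change except possibly at one place is constant. -/
theorem eq_of_constant_off {C : Type*} (a : Fin m → C) (j : Fin m)
    (h : ∀ i, i + 1 ≠ j → a (i + 1) = a i) (i : Fin m) : a i = a j := by
  have key : ∀ t : ℕ, t < m → a (j + Fin.ofNat m t) = a j := by
    intro t
    induction t with
    | zero => intro _; congr 1; ext; simp
    | succ t ih =>
      intro ht
      have hs : j + Fin.ofNat m (t + 1) = j + Fin.ofNat m t + 1 := by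
        ext; simp [Fin.val_add, add_assoc]
      rw [hs, h, ih (by omega)]
      rw [← hs]
      intro hj
      rw [add_eq_left, Fin.ext_iff] at hj
      simp [Nat.mod_eq_of_lt ht] at hj
  have := key (i - j).val (i - j).2
  rwa [Fin.ofNat_val_eq_self, add_sub_cancel] at this

/-- A set of residues which is nonempty and closed under successors is everything. -/
theorem mem_of_closed_succ {P : Fin m → Prop} {j : Fin m} (hj : P j)
    (h : ∀ i, P i → P (i + 1)) (i : Fin m) : P i := by
  have key : ∀ t : ℕ, P (j + Fin.ofNat m t) := by
    intro t
    induction t with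
    | zero => convert hj using 1; ext; simp
    | succ t ih =>
      have hs : j + Fin.ofNat m (t + 1) = j + Fin.ofNat m t + 1 := by
        ext; simp [Fin.val_add, add_assoc]
      rw [hs]
      exact h _ ih
  have := key (i - j).val
  rwa [Fin.ofNat_val_eq_self, add_sub_cancel] at this

/-- In a cyclic sequence which changes at `s`, there is a last place of the block that starts
at `s`. -/
theorem exists_block_end {C : Type*} (a : Fin m → C) {s : Fin m} (hs : a (s + 1) ≠ a s) :
    ∃ e, a e = a (s + 1) ∧ a (e + 1) ≠ a e := by
  by_contra! h
  have := mem_of_closed_succ (P := fun i => a i = a (s + 1)) rfl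
    (fun i hi => (h i hi).trans hi) s
  exact hs this.symm

theorem le_of_locating_add_one (hm : 3 ≤ m) (hn : 2 ≤ n)
    {c : Fin m ⊕ (Fin m × Fin n) → Fin (n + 1)}
    (hc : IsLocatingRainbowColoring (cycleCorona m n) c) : m ≤ n + 1 := by
  have hinj := clique_color_injective hc
  choose a ha using fun i => exists_missing_value (hinj i)
  have hthird : ∀ b b' : Fin (n + 1), ∃ d, d ≠ b ∧ d ≠ b' := by
    intro b b'
    obtain ⟨d, hd⟩ := Finset.exists_mem_notMem_of_card_lt_card
      (s := {b, b'}) (t := (Finset.univ : Finset (Fin (n + 1))))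
      (lt_of_le_of_lt (Finset.card_le_two) (by simp; omega))
    exact ⟨d, by simpa using hd⟩
  have hsees : ∀ i t, ∀ b ≠ a i, SeesColor (cycleCorona m n) c (Sum.inr (i, t)) b :=
    fun i t b hb => (sees_clique_iff c i t b).2 (Or.inr (Or.inr ((ha i b).2 hb)))
  -- cliques with an end of the missing colour
  set Q : Fin m → Prop := fun i => c (Sum.inl i) = a i ∨ c (Sum.inl (i + 1)) = a i with hQ
  have hseesQ : ∀ i t, Q i → ∀ b, SeesColor (cycleCorona m n) c (Sum.inr (i, t)) b := by
    intro i t hi b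
    by_cases hb : b = a i
    · rw [sees_clique_iff, hb]
      exact hi.elim Or.inl fun h => Or.inr (Or.inl h)
    · exact hsees i t b hb
  -- Since n + 1 ≥ 3, two cliques always share a colour; if both also see their missing colours, the
  -- two vertices of that colour see everything.
  have hQ_unique : ∀ i j, Q i → Q j → i = j := by
    intro i j hi hj
    obtain ⟨d, hdi, hdj⟩ := hthird (a i) (a j)
    obtain ⟨s, hs⟩ := (ha i d).2 hdi
    obtain ⟨t, ht⟩ := (ha j d).2 hdj
    have := hc.eq_of_sees (hs.trans ht.symm) (hseesQ i s hi) (hseesQ j t hj)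
    simp only [Sum.inr.injEq, Prod.mk.injEq] at this
    exact this.1
  have hfull : ∀ i, a (i + 1) ≠ a i →
      ∀ b, SeesColor (cycleCorona m n) c (Sum.inl (i + 1)) b := by
    intro i hi b
    rw [sees_core_iff (by omega), ha, ha]
    by_cases hb : b = a i
    · exact Or.inr (Or.inr (Or.inr (Or.inr (hb ▸ hi.symm))))
    · exact Or.inr (Or.inr (Or.inr (Or.inl hb)))
  have hfull_color : ∀ i j, Q i → a (j + 1) ≠ a j → c (Sum.inl (j + 1)) = a i := by
    intro i j hi hj
    by_contra hne
    obtain ⟨t, ht⟩ := (ha i _).2 hne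
    have := hc.eq_of_sees ht (hseesQ i t hi) (hfull j hj)
    simp at this
  -- If the missing colour were constant, a core vertex carrying it would serve both adjacent
  -- cliques, against `hQ_unique`; if no core vertex carries it, it is unused and lies at distance
  -- `⊤` from every vertex.
  have hnonconst : ¬ ∀ i, a (i + 1) = a i := by
    intro hconst
    have hall : ∀ i j, a i = a j := fun i j =>
      eq_of_constant_off a j (fun i _ => hconst i) i
    have hne : (0 : Fin m) + 1 ≠ 0 := fin_add_one_ne (by omega) 0
    by_cases hused : ∃ i, c (Sum.inl i) = a 0
    · obtain ⟨i, hi⟩ := hused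
      have h₁ : Q i := Or.inl (hi.trans (hall _ _))
      have h₂ : Q (i - 1) := Or.inr (by rw [sub_add_cancel, hi]; exact hall _ _)
      have h := hQ_unique _ _ h₁ h₂
      have h' := fin_add_one_ne (show 2 ≤ m by omega) (i - 1)
      rw [sub_add_cancel] at h'
      exact h' h
    · have htop : ∀ x, rainbowCode (cycleCorona m n) c x (a 0) = ⊤ := by
        intro x
        have hempty : {w | c w = a 0} = ∅ := by
          ext w
          simp only [Set.mem_ofPred_eq, Set.mem_empty_iff_false, iff_false]
          rcases w with i | ⟨i, t⟩
          · exact fun h => hused ⟨i, h⟩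
          · exact fun h => (ha i (a 0)).1 ⟨t, h⟩ (hall _ _)
        simp [rainbowCode, distToSet, hempty]
      obtain ⟨d, hd, -⟩ := hthird (a 0) (a 0)
      obtain ⟨s, hs⟩ := (ha 0 d).2 hd
      obtain ⟨t, ht⟩ := (ha (0 + 1) d).2 (by rw [hall _ 0]; exact hd)
      have := hc.eq_of_sees_ne (a := a 0) (ht.trans hs.symm)
        (fun b hb => hsees (0 + 1) t b (by rw [hall _ 0]; exact hb)) (hsees 0 s)
        (by rw [htop, htop])
      simp only [Sum.inr.injEq, Prod.mk.injEq] at this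
      exact hne this.1
  push Not at hnonconst
  obtain ⟨j₀, hj₀⟩ := hnonconst
  -- By `hfull_color`, `Q i` gives the colour `a i` to every core vertex at a change of `a`. These
  -- vertices see everything, so there is only one change, and a cyclic sequence cannot change
  -- exactly once.
  have hnoQ : ∀ i, ¬ Q i := by
    intro i hi
    refine hj₀ ?_
    refine (eq_of_constant_off a (j₀ + 1) (fun l hl => ?_) j₀).symm
    by_contra hne
    refine hl ?_
    have := hc.eq_of_sees ((hfull_color i l hi hne).trans (hfull_color i j₀ hi hj₀).symm)
      (hfull l hne) (hfull j₀ hj₀)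
    simpa using this
  have hnotsees : ∀ i t, ¬ SeesColor (cycleCorona m n) c (Sum.inr (i, t)) (a i) := by
    intro i t h
    rw [sees_clique_iff] at h
    rcases h with h | h | h
    · exact hnoQ i (Or.inl h)
    · exact hnoQ i (Or.inr h)
    · exact (ha i (a i)).1 h rfl
  -- The neighbouring clique with another missing colour contains `a i`, and it is reached through
  -- the common core vertex.
  have hdist : ∀ i, (a i ≠ a (i - 1) ∨ a (i + 1) ≠ a i) →
      ∀ t, rainbowCode (cycleCorona m n) c (Sum.inr (i, t)) (a i) = 2 := by
    rintro i (h | h) t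
    · obtain ⟨s, hs⟩ := (ha (i - 1) (a i)).2 h
      have := rainbowCode_eq_two (c := c)
        ((cycleCorona_adj_clique_core i (i, t)).2 (Or.inl rfl))
        ((cycleCorona_adj_core_clique i (i - 1, s)).2 (Or.inr (sub_add_cancel i 1).symm))
        (by rw [hs]; exact hnotsees i t)
      rwa [hs] at this
    · obtain ⟨s, hs⟩ := (ha (i + 1) (a i)).2 h.symm
      have := rainbowCode_eq_two (c := c)
        ((cycleCorona_adj_clique_core (i + 1) (i, t)).2 (Or.inr rfl))
        ((cycleCorona_adj_core_clique (i + 1) (i + 1, s)).2 (Or.inl rfl))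
        (by rw [hs]; exact hnotsees i t)
      rwa [hs] at this
  have hnear : ∀ i j, (a i ≠ a (i - 1) ∨ a (i + 1) ≠ a i) →
      (a j ≠ a (j - 1) ∨ a (j + 1) ≠ a j) → a i = a j → i = j := by
    intro i j hi hj hij
    obtain ⟨d, hd, -⟩ := hthird (a i) (a i)
    obtain ⟨s, hs⟩ := (ha i d).2 hd
    obtain ⟨t, ht⟩ := (ha j d).2 (hij ▸ hd)
    have := hc.eq_of_sees_ne (a := a i) (hs.trans ht.symm) (hsees i s)
      (fun b hb => hsees j t b (hij ▸ hb)) (by rw [hdist i hi, hij, hdist j hj])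
    simp only [Sum.inr.injEq, Prod.mk.injEq] at this
    exact this.1
  -- The first and last clique of a block of constant `a` both satisfy the condition of `hnear`, so
  -- every block has length one.
  have hall : ∀ i, a (i + 1) ≠ a i := by
    refine mem_of_closed_succ (P := fun i => a (i + 1) ≠ a i) hj₀ fun i hi => ?_
    obtain ⟨e, he, he'⟩ := exists_block_end a hi
    have : i + 1 = e := hnear _ _ (Or.inl (by rwa [add_sub_cancel_right])) (Or.inr he') he.symm
    rwa [this]
  have hcore : Function.Injective fun i => c (Sum.inl (i + 1)) := by
    intro i j hij
    simpa using hc.eq_of_sees hij (hfull i (hall i)) (hfull j (hall j))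
  simpa using Fintype.card_le_of_injective _ hcore

theorem add_two_le_of_locating (hn : 2 ≤ n) (hnm : n + 2 ≤ m)
    {c : Fin m ⊕ (Fin m × Fin n) → Fin k}
    (hc : IsLocatingRainbowColoring (cycleCorona m n) c) : n + 2 ≤ k := by
  have h := add_one_le_of_locating (by omega) (by omega) hc
  by_contra hk
  obtain rfl : k = n + 1 := by omega
  have := le_of_locating_add_one (by omega) hn hc
  omega

end LocatingLowerBound

/-! ### Lower bound from the rainbow condition -/

/-- A cyclic sequence of length `m` that is injective on one of the two arcs for every way of
cutting the cycle into two arcs takes at least `m / 2` values. -/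
theorem le_two_mul_of_injOn_arc {m k : ℕ} (hm : 5 ≤ m) {f : ℕ → Fin k}
    (hf : ∀ i j, i < j → j < m → Set.InjOn f {q | i < q ∧ q ≤ j} ∨
      Set.InjOn f {q | q < m ∧ (q ≤ i ∨ j < q)}) : m ≤ 2 * k := by
  by_contra! hk
  have hinner : ∀ i j, Set.InjOn f {q | i < q ∧ q ≤ j} → j - i ≤ k := by
    intro i j h
    have := Finset.card_le_card_of_injOn (s := Finset.Ioc i j) (t := Finset.univ) f
      (fun _ _ => Finset.mem_coe.2 (Finset.mem_univ _)) (h.mono (by intro q; simp))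
    simpa using this
  have houter : ∀ i j, i < j → j < m → Set.InjOn f {q | q < m ∧ (q ≤ i ∨ j < q)} →
      m - (j - i) ≤ k := by
    intro i j hij hj h
    have hsub : Finset.Ioc i j ⊆ Finset.range m := by
      intro q
      simp only [Finset.mem_Ioc, Finset.mem_range]
      omega
    have := Finset.card_le_card_of_injOn (s := Finset.range m \ Finset.Ioc i j)
      (t := Finset.univ) f (fun _ _ => Finset.mem_coe.2 (Finset.mem_univ _))
      (h.mono (by
        intro q
        simp only [Finset.coe_sdiff, Finset.coe_range, Finset.coe_Ioc, Set.mem_sdiff, Set.mem_Iio,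
          Set.mem_Ioc, Set.mem_ofPred_eq]
        omega))
    rw [Finset.card_sdiff_of_subset hsub] at this
    simpa using this
  obtain ⟨t, rfl | rfl⟩ : ∃ t, m = 2 * t ∨ m = 2 * t + 1 := ⟨m / 2, by omega⟩
  -- In the even case both arcs have t > k places.
  · rcases hf 0 t (by omega) (by omega) with h | h
    · have := hinner _ _ h
      omega
    · have := houter _ _ (by omega) (by omega) h
      omega
  -- In the odd case k ≤ t, so of two arcs with t and t + 1 places only the shorter can be
  -- injective. Hence any t cyclically consecutive places carry different values.
  have hin : ∀ i, i + t < 2 * t + 1 → Set.InjOn f {q | i < q ∧ q ≤ i + t} := by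
    intro i hi
    refine (hf i (i + t) (by omega) hi).resolve_right fun h => ?_
    have := houter _ _ (by omega) hi h
    omega
  have hout : ∀ i, i + t + 1 < 2 * t + 1 →
      Set.InjOn f {q | q < 2 * t + 1 ∧ (q ≤ i ∨ i + t + 1 < q)} := by
    intro i hi
    refine (hf i (i + t + 1) (by omega) hi).resolve_left fun h => ?_
    have := hinner _ _ h
    omega
  have hgap : ∀ p q, p < q → q < 2 * t + 1 → f p = f q → t ≤ q - p := by
    intro p q hpq hq hf
    by_contra! hlt
    rcases Nat.eq_zero_or_pos p with rfl | hp
    · have := @hout (t - 1) (by omega) 0 ⟨by omega, by omega⟩ q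
        ⟨by omega, by omega⟩ hf
      omega
    · have := @hin (q - t) (by omega) p ⟨by omega, by omega⟩ q
        ⟨by omega, by omega⟩ hf
      omega
  have hwrap : ∀ p r, p < r → r < 2 * t + 1 → f p = f r → t ≤ p + (2 * t + 1) - r := by
    intro p r hpr hr hf
    by_contra! hlt
    have := @hout p (by omega) p ⟨by omega, by omega⟩ r ⟨by omega, by omega⟩ hf
    omega
  -- Three cyclic gaps of at least t would need 3t ≤ 2t + 1, but t ≥ 2. The pigeonhole principle
  -- provides three places of one value.
  have hthree : ∀ p q r, p < q → q < r → r < 2 * t + 1 → f p = f q → f q = f r → False := by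
    intro p q r hpq hqr hr h₁ h₂
    have := hgap p q hpq (by omega) h₁
    have := hgap q r hqr hr h₂
    have := hwrap p r (by omega) hr (h₁.trans h₂)
    omega
  obtain ⟨y, -, hy⟩ := Finset.exists_lt_card_fiber_of_mul_lt_card_of_maps_to
    (s := Finset.range (2 * t + 1)) (t := (Finset.univ : Finset (Fin k))) (f := f) (n := 2)
    (fun _ _ => Finset.mem_univ _) (by simpa [mul_comm] using hk)
  obtain ⟨p, hp, q, hq, r, hr, hpq, hpr, hqr⟩ := Finset.two_lt_card.1 hy
  simp only [Finset.mem_filter, Finset.mem_range] at hp hq hr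
  obtain ⟨hp, hp'⟩ := hp
  obtain ⟨hq, hq'⟩ := hq
  obtain ⟨hr, hr'⟩ := hr
  rcases hpq.lt_or_gt with h₁ | h₁ <;> rcases hpr.lt_or_gt with h₂ | h₂ <;>
    rcases hqr.lt_or_gt with h₃ | h₃
  · exact hthree p q r h₁ h₃ hr (by rw [hp', hq']) (by rw [hq', hr'])
  · exact hthree p r q h₂ h₃ hq (by rw [hp', hr']) (by rw [hr', hq'])
  · omega
  · exact hthree r p q h₂ h₁ hq (by rw [hr', hp']) (by rw [hp', hq'])
  · exact hthree q p r h₁ h₂ hr (by rw [hq', hp']) (by rw [hp', hr'])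
  · omega
  · exact hthree q r p h₃ h₂ hp (by rw [hq', hr']) (by rw [hr', hp'])
  · exact hthree r q p h₃ h₁ hp (by rw [hr', hq']) (by rw [hq', hp'])

section RainbowLowerBound

variable {m n k : ℕ} [NeZero m]

theorem mem_interior_of_mem_support {V : Type*} {G : SimpleGraph V} {u v w : V} (p : G.Walk u v)
    (hw : w ∈ p.support) (hu : w ≠ u) (hv : w ≠ v) : w ∈ p.support.tail.dropLast := by
  rw [← p.cons_tail_support, List.mem_cons] at hw
  have hw' := hw.resolve_left hu
  have hne : p.support.tail ≠ [] := List.ne_nil_of_mem hw'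
  rw [← List.dropLast_append_getLast hne, List.mem_append, List.getLast_tail,
    p.getLast_support] at hw'
  exact hw'.resolve_right (by simpa using hv)

/-- The vertices strictly between the core vertices `s` and `t`. -/
def coreBetween (m n : ℕ) (s t : ℕ) : Set (Fin m ⊕ (Fin m × Fin n)) :=
  {x | Sum.elim (fun i : Fin m => s < i.val ∧ i.val < t)
    (fun p : Fin m × Fin n => s ≤ p.1.val ∧ p.1.val < t) x}

/-- The two core vertices form a cut: an edge leaving the segment between them must end in one of
them. -/
theorem mem_support_of_separated (hm : 2 ≤ m) {s t : Fin m} {u v : Fin m ⊕ (Fin m × Fin n)}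
    (p : (cycleCorona m n).Walk u v) (hu : u ∈ coreBetween m n s t) (hv : v ∉ coreBetween m n s t) :
    Sum.inl s ∈ p.support ∨ Sum.inl t ∈ p.support := by
  obtain ⟨d, hd, h₁, h₂⟩ := p.exists_boundary_dart _ hu hv
  have hmem := p.dart_snd_mem_support_of_mem_darts hd
  have hadj := d.adj
  generalize d.fst = x at h₁ hadj
  generalize d.snd = y at h₂ hadj hmem
  suffices y = Sum.inl s ∨ y = Sum.inl t by
    rcases this with rfl | rfl
    · exact Or.inl hmem
    · exact Or.inr hmem
  have hv := fun i => val_add_one_fin hm i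
  rcases x with i | ⟨i, q⟩ <;> rcases y with j | ⟨j, r⟩
  · rw [cycleCorona_adj_core hm] at hadj
    simp only [coreBetween, Set.mem_ofPred_eq, Sum.elim_inl] at h₁ h₂
    simp only [Sum.inl.injEq, Fin.ext_iff] at hadj ⊢
    rw [hv, hv] at hadj
    have := t.2
    split_ifs at hadj <;> omega
  · rw [cycleCorona_adj_core_clique] at hadj
    simp only [coreBetween, Set.mem_ofPred_eq, Sum.elim_inl, Sum.elim_inr] at h₁ h₂
    simp only [Fin.ext_iff] at hadj
    rw [hv] at hadj
    split_ifs at hadj <;> omega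
  · rw [cycleCorona_adj_clique_core] at hadj
    simp only [coreBetween, Set.mem_ofPred_eq, Sum.elim_inl, Sum.elim_inr] at h₁ h₂
    simp only [Sum.inl.injEq, Fin.ext_iff] at hadj ⊢
    rw [hv] at hadj
    have := t.2
    split_ifs at hadj <;> omega
  · rw [cycleCorona_adj_clique] at hadj
    simp only [coreBetween, Set.mem_ofPred_eq, Sum.elim_inr] at h₁ h₂
    have : i = j := hadj.2
    subst this
    exact absurd h₁ h₂

/-- A rainbow colouring is injective on one of the two arcs of the core between two cliques. -/
theorem injOn_arc_of_rainbow (hm : 2 ≤ m) (hn : 1 ≤ n) {C : Type*}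
    {c : Fin m ⊕ (Fin m × Fin n) → C} (hc : IsRainbowVertexColoring (cycleCorona m n) c)
    {i j : Fin m} :
    Set.InjOn (fun q => c (Sum.inl q)) (Set.Ioc i j) ∨
      Set.InjOn (fun q => c (Sum.inl q)) (Set.Ioc i j)ᶜ := by
  obtain ⟨p, -, hp⟩ := hc (Sum.inr (i, ⟨0, hn⟩)) (Sum.inr (j, ⟨0, hn⟩))
  have key : ∀ A : Set (Fin m), (∀ q ∈ A, Sum.inl q ∈ p.support) →
      Set.InjOn (fun q => c (Sum.inl q)) A := by
    intro A hA q hq r hr hqr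
    have hmem : ∀ q ∈ A, Sum.inl q ∈ p.support.tail.dropLast := fun q hq =>
      mem_interior_of_mem_support p (hA q hq) (by simp) (by simp)
    simpa using List.inj_on_of_nodup_map hp (hmem q hq) (hmem r hr) hqr
  by_contra! hcon
  obtain ⟨s, hs, hs'⟩ : ∃ s ∈ Set.Ioc i j, Sum.inl s ∉ p.support := by
    by_contra! h
    exact hcon.1 (key _ h)
  obtain ⟨t, ht, ht'⟩ : ∃ t ∈ (Set.Ioc i j)ᶜ, Sum.inl t ∉ p.support := by
    by_contra! h
    exact hcon.2 (key _ h)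
  simp only [Set.mem_compl_iff, Set.mem_Ioc, Fin.lt_def, Fin.le_def] at hs ht
  -- The two missed core vertices, one on each arc, enclose clique `i` if `t` comes before the inner
  -- arc and clique `j` otherwise; the enclosed clique must be where the walk starts, hence the
  -- reversal.
  by_cases hti : t.val ≤ i.val
  · have := mem_support_of_separated hm (s := t) (t := s) p
      (by simp only [coreBetween, Set.mem_ofPred_eq, Sum.elim_inr]; omega)
      (by simp only [coreBetween, Set.mem_ofPred_eq, Sum.elim_inr]; omega)
    tauto
  · have := mem_support_of_separated hm (s := s) (t := t) p.reverse
      (by simp only [coreBetween, Set.mem_ofPred_eq, Sum.elim_inr]; omega)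
      (by simp only [coreBetween, Set.mem_ofPred_eq, Sum.elim_inr]; omega)
    simp only [SimpleGraph.Walk.support_reverse, List.mem_reverse] at this
    tauto

theorem le_two_mul_of_rainbow (hm : 5 ≤ m) (hn : 1 ≤ n) {c : Fin m ⊕ (Fin m × Fin n) → Fin k}
    (hc : IsRainbowVertexColoring (cycleCorona m n) c) : m ≤ 2 * k := by
  refine le_two_mul_of_injOn_arc hm (f := fun q => c (Sum.inl (Fin.ofNat m q))) ?_
  intro i j hij hj
  have hlift : ∀ (A : Set (Fin m)) (B : Set ℕ),
      (∀ q ∈ B, q < m ∧ ∀ r : Fin m, r.val = q → r ∈ A) →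
      Set.InjOn (fun q => c (Sum.inl q)) A →
      Set.InjOn (fun q => c (Sum.inl (Fin.ofNat m q))) B := by
    intro A B hAB hA q hq r hr hqr
    have hval : ∀ q ∈ B, (Fin.ofNat m q).val = q := fun q hq => by
      simp [Nat.mod_eq_of_lt (hAB q hq).1]
    have := hA ((hAB q hq).2 _ (hval q hq)) ((hAB r hr).2 _ (hval r hr)) hqr
    rw [← hval q hq, ← hval r hr, this]
  refine (injOn_arc_of_rainbow (by omega) hn hc (i := ⟨i, by omega⟩) (j := ⟨j, hj⟩)).imp
    (hlift _ _ ?_) (hlift _ _ ?_)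
  · rintro q ⟨h₁, h₂⟩
    refine ⟨by omega, ?_⟩
    rintro r rfl
    exact ⟨h₁, h₂⟩
  · rintro q ⟨h₁, h₂⟩
    refine ⟨h₁, ?_⟩
    rintro r rfl
    rw [Set.mem_compl_iff, Set.mem_Ioc, Fin.lt_def, Fin.le_def]
    simp only
    omega

end RainbowLowerBound

/-! ### Rainbow criterion and sufficient conditions for a locating colouring -/

section Construction

variable {m n k : ℕ} [NeZero m]

/-- Two core vertices are joined by a walk through the core vertices between them. -/
theorem exists_core_walk (hm : 2 ≤ m) (a : Fin m) : ∀ b : ℕ, ∀ hb : b < m, a.val ≤ b →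
    ∃ p : (cycleCorona m n).Walk (Sum.inl a) (Sum.inl ⟨b, hb⟩),
      ∀ w ∈ p.support, ∃ q : Fin m, w = Sum.inl q ∧ a.val ≤ q.val ∧ q.val ≤ b := by
  intro b
  induction b with
  | zero =>
    intro hb hab
    obtain rfl : a = ⟨0, hb⟩ := Fin.ext (by simpa using hab)
    exact ⟨.nil, by simp⟩
  | succ b ih =>
    intro hb hab
    rcases hab.lt_or_eq with hlt | heq
    · obtain ⟨p, hp⟩ := ih (by omega) (by omega)
      have hadj : (cycleCorona m n).Adj (Sum.inl ⟨b, by omega⟩) (Sum.inl ⟨b + 1, hb⟩) := by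
        rw [cycleCorona_adj_core hm]
        left
        rw [Fin.ext_iff, val_add_one_fin hm, if_neg (by simp only; omega)]
      refine ⟨p.concat hadj, fun w hw => ?_⟩
      rw [SimpleGraph.Walk.support_concat, List.mem_append,
        List.mem_singleton] at hw
      rcases hw with hw | rfl
      · obtain ⟨q, rfl, h₁, h₂⟩ := hp w hw
        exact ⟨q, rfl, h₁, by omega⟩
      · exact ⟨_, rfl, by simp only; omega, le_rfl⟩
    · obtain rfl : a = ⟨b + 1, hb⟩ := Fin.ext heq
      exact ⟨.nil, by simp⟩

/-- The index of the clique to which a vertex of `cycleCorona` is assigned. -/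
def coronaIndex : Fin m ⊕ (Fin m × Fin n) → Fin m :=
  Sum.elim id Prod.fst

theorem eq_or_adj_coronaIndex (u : Fin m ⊕ (Fin m × Fin n)) :
    u = Sum.inl (coronaIndex u) ∨ (cycleCorona m n).Adj u (Sum.inl (coronaIndex u)) := by
  rcases u with i | p
  · exact Or.inl rfl
  · exact Or.inr ((cycleCorona_adj_clique_core _ _).2 (Or.inl rfl))

theorem adj_coronaIndex_add_one (hm : 2 ≤ m) (u : Fin m ⊕ (Fin m × Fin n)) :
    (cycleCorona m n).Adj u (Sum.inl (coronaIndex u + 1)) := by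
  rcases u with i | p
  · exact (cycleCorona_adj_core hm _ _).2 (Or.inl rfl)
  · exact (cycleCorona_adj_clique_core _ _).2 (Or.inr rfl)

theorem eq_or_adj_of_coronaIndex_eq (u v : Fin m ⊕ (Fin m × Fin n))
    (h : coronaIndex u = coronaIndex v) : u = v ∨ (cycleCorona m n).Adj u v := by
  rcases u with i | p <;> rcases v with j | q
  · exact Or.inl (congrArg Sum.inl h)
  · exact Or.inr ((cycleCorona_adj_core_clique _ _).2 (Or.inl h))
  · exact Or.inr ((cycleCorona_adj_clique_core _ _).2 (Or.inl h.symm))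
  · by_cases hpq : p = q
    · exact Or.inl (by rw [hpq])
    · exact Or.inr ((cycleCorona_adj_clique _ _).2 ⟨hpq, h⟩)

theorem exists_walk_from_coronaIndex (u : Fin m ⊕ (Fin m × Fin n)) :
    ∃ p : (cycleCorona m n).Walk (Sum.inl (coronaIndex u)) u,
      ∀ w ∈ p.support, w = u ∨ w = Sum.inl (coronaIndex u) := by
  rcases eq_or_adj_coronaIndex u with h | h
  · exact ⟨SimpleGraph.Walk.nil.copy rfl h.symm, by simp⟩
  · refine ⟨.cons h.symm .nil, fun w hw => ?_⟩
    simp only [SimpleGraph.Walk.support_cons, SimpleGraph.Walk.support_nil, List.mem_cons,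
      List.not_mem_nil, or_false] at hw
    exact hw.symm

theorem exists_walk_arc (hm : 2 ≤ m) {u v : Fin m ⊕ (Fin m × Fin n)}
    (h : (coronaIndex u).val < (coronaIndex v).val) :
    ∃ p : (cycleCorona m n).Walk u v, ∀ w ∈ p.support, w = u ∨ w = v ∨
      ∃ q : Fin m, w = Sum.inl q ∧ (coronaIndex u).val < q.val ∧
        q.val ≤ (coronaIndex v).val := by
  have hval : (coronaIndex u + 1).val = (coronaIndex u).val + 1 := by
    rw [val_add_one_fin hm, if_neg (by omega)]
  obtain ⟨p, hp⟩ := exists_core_walk (n := n) hm (coronaIndex u + 1) _ (coronaIndex v).2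
    (by omega)
  obtain ⟨q, hq⟩ := exists_walk_from_coronaIndex v
  refine ⟨.cons (adj_coronaIndex_add_one hm u) (p.append q), fun w hw => ?_⟩
  rw [SimpleGraph.Walk.support_cons, List.mem_cons, SimpleGraph.Walk.mem_support_append_iff] at hw
  rcases hw with rfl | hw | hw
  · exact Or.inl rfl
  · obtain ⟨r, rfl, h₁, h₂⟩ := hp w hw
    exact Or.inr (Or.inr ⟨r, rfl, by omega, h₂⟩)
  · rcases hq w hw with rfl | rfl
    · exact Or.inr (Or.inl rfl)
    · exact Or.inr (Or.inr ⟨_, rfl, h, le_rfl⟩)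

theorem exists_walk_complementary_arc (hm : 2 ≤ m) {u v : Fin m ⊕ (Fin m × Fin n)}
    (h : (coronaIndex u).val < (coronaIndex v).val) :
    ∃ p : (cycleCorona m n).Walk v u, ∀ w ∈ p.support, w = v ∨ w = u ∨
      ∃ q : Fin m, w = Sum.inl q ∧ (q.val ≤ (coronaIndex u).val ∨
        (coronaIndex v).val < q.val) := by
  obtain ⟨p, hp⟩ := exists_core_walk (n := n) hm ⟨0, by omega⟩ _ (coronaIndex u).2 (Nat.zero_le _)
  obtain ⟨q, hq⟩ := exists_walk_from_coronaIndex u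
  have hpq : ∀ w ∈ (p.append q).support, w = v ∨ w = u ∨
      ∃ q : Fin m, w = Sum.inl q ∧ (q.val ≤ (coronaIndex u).val ∨
        (coronaIndex v).val < q.val) := by
    intro w hw
    rw [SimpleGraph.Walk.mem_support_append_iff] at hw
    rcases hw with hw | hw
    · obtain ⟨r, rfl, h₁, h₂⟩ := hp w hw
      exact Or.inr (Or.inr ⟨r, rfl, Or.inl h₂⟩)
    · rcases hq w hw with rfl | rfl
      · exact Or.inr (Or.inl rfl)
      · exact Or.inr (Or.inr ⟨_, rfl, Or.inl le_rfl⟩)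
  have hadj := adj_coronaIndex_add_one hm v
  have hval := val_add_one_fin hm (coronaIndex v)
  split_ifs at hval with hlast
  · have h0 : coronaIndex v + 1 = ⟨0, by omega⟩ := Fin.ext hval
    rw [h0] at hadj
    refine ⟨.cons hadj (p.append q), fun w hw => ?_⟩
    rw [SimpleGraph.Walk.support_cons, List.mem_cons] at hw
    exact hw.elim Or.inl (hpq w)
  · have hlt := (coronaIndex v).2
    obtain ⟨r, hr⟩ := exists_core_walk (n := n) hm (coronaIndex v + 1) (m - 1) (by omega)
      (by omega)
    have hadj' : (cycleCorona m n).Adj (Sum.inl ⟨m - 1, by omega⟩) (Sum.inl ⟨0, by omega⟩) := by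
      rw [cycleCorona_adj_core hm]
      left
      rw [Fin.ext_iff, val_add_one_fin hm, if_pos (by simp only; omega)]
    refine ⟨.cons hadj (r.append (.cons hadj' (p.append q))), fun w hw => ?_⟩
    rw [SimpleGraph.Walk.support_cons, List.mem_cons, SimpleGraph.Walk.mem_support_append_iff,
      SimpleGraph.Walk.support_cons, List.mem_cons] at hw
    rcases hw with rfl | hw | rfl | hw
    · exact Or.inl rfl
    · obtain ⟨r, rfl, h₁, h₂⟩ := hr w hw
      exact Or.inr (Or.inr ⟨r, rfl, Or.inr (by omega)⟩)
    · exact Or.inr (Or.inr ⟨_, rfl, Or.inr (by simp only; omega)⟩)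
    · exact hpq w hw

/-- A colouring that is injective on one of the two arcs of the core for every way of cutting the
core into two arcs is a rainbow colouring. -/
theorem isRainbow_of_injOn_arc (hm : 2 ≤ m) {C : Type*} {c : Fin m ⊕ (Fin m × Fin n) → C}
    (hc : ∀ i j : Fin m, i < j → Set.InjOn (fun q => c (Sum.inl q)) (Set.Ioc i j) ∨
      Set.InjOn (fun q => c (Sum.inl q)) (Set.Ioc i j)ᶜ) :
    IsRainbowVertexColoring (cycleCorona m n) c := by
  have hinj : ∀ A : Set (Fin m), Set.InjOn (fun q => c (Sum.inl q)) A →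
      Set.InjOn c (Sum.inl '' A) := by
    rintro A hA _ ⟨q, hq, rfl⟩ _ ⟨r, hr, rfl⟩ hqr
    rw [hA hq hr hqr]
  intro u v
  rcases lt_trichotomy (coronaIndex u) (coronaIndex v) with h | h | h
  · rcases hc _ _ h with hi | hi
    · obtain ⟨p, hp⟩ := exists_walk_arc hm h
      refine exists_rainbow_path (hinj _ hi) p fun w hw => ?_
      rcases hp w hw with hw | hw | ⟨q, rfl, h₁, h₂⟩
      · exact Or.inl hw
      · exact Or.inr (Or.inl hw)
      · exact Or.inr (Or.inr ⟨q, ⟨h₁, h₂⟩, rfl⟩)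
    · obtain ⟨p, hp⟩ := exists_walk_complementary_arc hm h
      refine exists_rainbow_path (hinj _ hi) p.reverse fun w hw => ?_
      rw [SimpleGraph.Walk.support_reverse, List.mem_reverse] at hw
      rcases hp w hw with hw | hw | ⟨q, rfl, h₁⟩
      · exact Or.inr (Or.inl hw)
      · exact Or.inl hw
      · refine Or.inr (Or.inr ⟨q, ?_, rfl⟩)
        rw [Set.mem_compl_iff, Set.mem_Ioc, Fin.lt_def, Fin.le_def]
        omega
  · rcases eq_or_adj_of_coronaIndex_eq u v h with rfl | h
    · exact ⟨.nil, .nil, by simp⟩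
    · refine exists_rainbow_path (S := ∅) (by simp) (.cons h .nil) fun w hw => ?_
      simp only [SimpleGraph.Walk.support_cons, SimpleGraph.Walk.support_nil, List.mem_cons,
        List.not_mem_nil, or_false] at hw
      tauto
  · rcases hc _ _ h with hi | hi
    · obtain ⟨p, hp⟩ := exists_walk_arc hm h
      refine exists_rainbow_path (hinj _ hi) p.reverse fun w hw => ?_
      rw [SimpleGraph.Walk.support_reverse, List.mem_reverse] at hw
      rcases hp w hw with hw | hw | ⟨q, rfl, h₁, h₂⟩
      · exact Or.inr (Or.inl hw)
      · exact Or.inl hw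
      · exact Or.inr (Or.inr ⟨q, ⟨h₁, h₂⟩, rfl⟩)
    · obtain ⟨p, hp⟩ := exists_walk_complementary_arc hm h
      refine exists_rainbow_path (hinj _ hi) p fun w hw => ?_
      rcases hp w hw with hw | hw | ⟨q, rfl, h₁⟩
      · exact Or.inl hw
      · exact Or.inr (Or.inl hw)
      · refine Or.inr (Or.inr ⟨q, ?_, rfl⟩)
        rw [Set.mem_compl_iff, Set.mem_Ioc, Fin.lt_def, Fin.le_def]
        omega

/-- The successor of `i` in the cyclic order of `{0, …, m - 1}`. -/
def cyclicSucc (m i : ℕ) : ℕ := if i + 1 = m then 0 else i + 1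

/-- The colour of the core vertex `i`: the colours `0, …, k - 1` in order, and then from `0` on. -/
def coreColor (k i : ℕ) : ℕ := if i < k then i else i - k

/-- Sufficient conditions for a colouring of the cliques to give, together with `coreColor`, a
locating rainbow colouring. Here `M i` is the set of colours of the clique `i`, and `P i` is the
set of colours of the clique `i` together with the two core vertices it is joined to. -/
theorem exists_locating_coloring (hm : 3 ≤ m) (hmk : m ≤ 2 * k) (h : ℕ → ℕ → ℕ) (M P : ℕ → ℕ → Prop)
    (hlt : ∀ i < m, ∀ t < n, h i t < k)
    (hM : ∀ i < m, ∀ d < k, (∃ t < n, h i t = d) ↔ M i d)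
    (hP : ∀ i < m, ∀ d < k,
      (coreColor k i = d ∨ coreColor k (cyclicSucc m i) = d ∨ M i d) ↔ P i d)
    (hinj : ∀ i < m, ∀ s < n, ∀ t < n, h i s = h i t → s = t)
    (hclique : ∀ i < m, ∀ j < m, ∀ d < k, M i d → M j d → (∀ d < k, P i d ↔ P j d) → i = j)
    (hcore : ∀ i < m, ∀ j < m, coreColor k (cyclicSucc m i) = coreColor k (cyclicSucc m j) →
      (∀ d < k, P i d ∨ P (cyclicSucc m i) d ↔ P j d ∨ P (cyclicSucc m j) d) → i = j)
    (hmixed : ∀ i < m, ∀ j < m, M j (coreColor k (cyclicSucc m i)) →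
      ¬ ∀ d < k, P i d ∨ P (cyclicSucc m i) d ↔ P j d) :
    ∃ c : Fin m ⊕ (Fin m × Fin n) → Fin k, IsLocatingRainbowColoring (cycleCorona m n) c := by
  have hγ : ∀ i : Fin m, coreColor k i.val < k := by
    intro i
    have := i.2
    unfold coreColor
    split_ifs <;> omega
  let c : Fin m ⊕ (Fin m × Fin n) → Fin k := Sum.elim (fun i => ⟨coreColor k i.val, hγ i⟩)
    (fun p => ⟨h p.1.val p.2.val, hlt _ p.1.2 _ p.2.2⟩)
  have hcl : ∀ i : Fin m, c (Sum.inl i) = ⟨coreColor k i.val, hγ i⟩ := fun _ => rfl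
  have hcr : ∀ i : Fin m, ∀ t : Fin n, (c (Sum.inr (i, t))).val = h i.val t.val := fun _ _ => rfl
  have hsucc : ∀ i : Fin m, (i + 1).val = cyclicSucc m i.val := fun i =>
    val_add_one_fin (by omega) i
  have hMc : ∀ (i : Fin m) (d : Fin k), (∃ t, c (Sum.inr (i, t)) = d) ↔ M i.val d.val := by
    intro i d
    rw [← hM _ i.2 _ d.2]
    constructor
    · rintro ⟨t, rfl⟩
      exact ⟨t.val, t.2, rfl⟩
    · rintro ⟨t, ht, htd⟩
      exact ⟨⟨t, ht⟩, Fin.ext htd⟩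
  have hseesr : ∀ (i : Fin m) (t : Fin n) (d : Fin k),
      SeesColor (cycleCorona m n) c (Sum.inr (i, t)) d ↔ P i.val d.val := by
    intro i t d
    rw [sees_clique_iff, hMc, ← hP _ i.2 _ d.2, hcl, hcl, Fin.ext_iff, Fin.ext_iff, ← hsucc]
  have hseesl : ∀ (i : Fin m) (d : Fin k), SeesColor (cycleCorona m n) c (Sum.inl (i + 1)) d ↔
      P i.val d.val ∨ P (cyclicSucc m i.val) d.val := by
    intro i d
    rw [sees_core_iff (by omega), hMc, hMc, ← hsucc, ← hP _ i.2 _ d.2, ← hP _ (i + 1).2 _ d.2, hcl,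
      hcl, hcl, Fin.ext_iff, Fin.ext_iff, Fin.ext_iff, ← hsucc, ← hsucc]
    simp only
    tauto
  refine ⟨c, isRainbow_of_injOn_arc (by omega) ?_, rainbowCode_injective_of_sees ?_⟩
  -- Distinct core vertices of equal colour are q and q + k. As m ≤ 2k, two such pairs interleave or
  -- coincide, so no cut places one pair on each arc.
  · intro i j hij
    by_contra! hcon
    simp only [Set.InjOn, not_forall] at hcon
    obtain ⟨⟨a, ha, b, hb, hab, hne⟩, ⟨a', ha', b', hb', hab', hne'⟩⟩ := hcon
    simp only [hcl, Fin.ext_iff, coreColor, Set.mem_compl_iff, Set.mem_Ioc, Fin.lt_def,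
      Fin.le_def] at *
    have := a.2
    have := b.2
    have := a'.2
    have := b'.2
    split_ifs at hab hab' <;> omega
  · have hpred : ∀ i : Fin m, ∃ j : Fin m, i = j + 1 := fun i => ⟨i - 1, (sub_add_cancel i 1).symm⟩
    rintro (x | ⟨i, s⟩) (y | ⟨j, t⟩) hcol hsee
    · obtain ⟨i, rfl⟩ := hpred x
      obtain ⟨j, rfl⟩ := hpred y
      simp only [hcl, Fin.ext_iff, hsucc] at hcol
      rw [Fin.ext (hcore _ i.2 _ j.2 hcol fun d hd => ?_)]
      rw [← hseesl i ⟨d, hd⟩, ← hseesl j ⟨d, hd⟩, hsee]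
    · obtain ⟨i, rfl⟩ := hpred x
      refine absurd (fun d hd => ?_) (hmixed _ i.2 _ j.2 ?_)
      · rw [← hseesl i ⟨d, hd⟩, ← hseesr j t ⟨d, hd⟩, hsee]
      · rw [← hsucc, ← hM _ j.2 _ (hγ _)]
        exact ⟨t.val, t.2, (Fin.ext_iff.1 hcol).symm⟩
    · obtain ⟨j, rfl⟩ := hpred y
      refine absurd (fun d hd => ?_) (hmixed _ j.2 _ i.2 ?_)
      · rw [← hseesl j ⟨d, hd⟩, ← hseesr i s ⟨d, hd⟩, hsee]
      · rw [← hsucc, ← hM _ i.2 _ (hγ _)]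
        exact ⟨s.val, s.2, Fin.ext_iff.1 hcol⟩
    · have hij : i = j := by
        refine Fin.ext (hclique _ i.2 _ j.2 _ (c (Sum.inr (i, s))).2 ((hMc i _).1 ⟨s, rfl⟩)
          ((hMc j _).1 ⟨t, hcol.symm⟩) fun d hd => ?_)
        rw [← hseesr i s ⟨d, hd⟩, ← hseesr j t ⟨d, hd⟩, hsee]
      subst hij
      rw [Fin.ext (hinj _ i.2 _ s.2 _ t.2 (Fin.ext_iff.1 hcol))]

end Construction

/-! ### Cyclic windows and the clique colours for k ≥ n + 2 -/

/-- The residue `c` belongs to the interval of length `l` that starts at `a`, modulo `k`. -/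
def InWindow (k a l c : ℕ) : Prop := a ≤ c ∧ c < a + l ∨ c + k < a + l

/-- Four colours decide this: the two ends of the first window and the two colours bordering the
second. -/
theorem window_le_of_subset {k a l b l' : ℕ} (ha : a < k) (hb : b < k) (hl : l ≤ k)
    (hl' : 1 ≤ l') (h : ∀ d < k, InWindow k a l d → InWindow k b l' d) : l ≤ l' := by
  by_contra! hlt
  have h₁ := h a ha (by unfold InWindow; omega)
  have h₂ := h (if a + l ≤ k then a + l - 1 else a + l - 1 - k) (by split_ifs <;> omega)
    (by unfold InWindow; split_ifs <;> omega)
  have h₃ := h (if b = 0 then k - 1 else b - 1) (by split_ifs <;> omega)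
  have h₄ := h (if b + l' < k then b + l' else b + l' - k) (by split_ifs <;> omega)
  unfold InWindow at *
  split_ifs at * <;> omega

/-- In a proper window the start is the only colour whose cyclic predecessor is outside. -/
theorem window_eq {k a l b l' : ℕ} (ha : a < k) (hb : b < k) (hl : 1 ≤ l) (hlk : l < k)
    (hl' : 1 ≤ l') (hlk' : l' < k) (h : ∀ d < k, InWindow k a l d ↔ InWindow k b l' d) :
    a = b ∧ l = l' := by
  have hll : l = l' := le_antisymm (window_le_of_subset ha hb hlk.le hl' fun d hd => (h d hd).1)
    (window_le_of_subset hb ha hlk'.le hl fun d hd => (h d hd).2)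
  subst hll
  refine ⟨?_, rfl⟩
  have h₁ := h a ha
  have h₂ := h b hb
  have h₃ := h (if a = 0 then k - 1 else a - 1) (by split_ifs <;> omega)
  have h₄ := h (if b = 0 then k - 1 else b - 1) (by split_ifs <;> omega)
  unfold InWindow at *
  split_ifs at * <;> omega

section CliqueColors

/-- The last clique gets an exceptional set of colours in two cases. -/
def ExceptionalClique (k m i : ℕ) : Prop := i + 1 = m ∧ (m = k + 1 ∨ m + 1 = 2 * k)

instance (k m i : ℕ) : Decidable (ExceptionalClique k m i) := by
  unfold ExceptionalClique
  infer_instance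

/-- The first colour of the clique `i`, for `i ≥ k`. -/
def windowStart (k m i : ℕ) : ℕ := if i + 1 = m ∨ i = k ∧ m + 1 = 2 * k then k - 1 else i - k

/-- The colour of the vertex `t` of the clique `i`. -/
def cliqueColor (n k m i t : ℕ) : ℕ :=
  if i < k then (if i + t < k then i + t else i + t - k)
  else if ExceptionalClique k m i then (if t + 1 < n then t else k - 2)
  else if t = 0 then windowStart k m i
  else if windowStart k m i + 1 + t < k then windowStart k m i + 1 + t
  else windowStart k m i + 1 + t - k

/-- The set of colours of the clique `i` and the two core vertices it is joined to. -/
def ClosedColors (n k m i d : ℕ) : Prop :=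
  if i < k then InWindow k i n d
  else if ExceptionalClique k m i then d + 1 < n ∨ d + 2 = k
  else InWindow k (windowStart k m i) (n + 1) d

/-- The set of colours of the clique `i`. -/
def CliqueColors (n k m i d : ℕ) : Prop :=
  ClosedColors n k m i d ∧ (k ≤ i → ¬ ExceptionalClique k m i →
    d ≠ if windowStart k m i + 1 = k then 0 else windowStart k m i + 1)

variable {n k m : ℕ}

theorem closedColors_cases (n : ℕ) {i : ℕ} (hk : 1 ≤ k) (hi : i < m) (hmk : m ≤ 2 * k) :
    (i < k ∧ ∀ d, ClosedColors n k m i d ↔ InWindow k i n d) ∨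
    (k ≤ i ∧ ExceptionalClique k m i ∧ ∀ d, ClosedColors n k m i d ↔ d + 1 < n ∨ d + 2 = k) ∨
    (k ≤ i ∧ ¬ ExceptionalClique k m i ∧ windowStart k m i < k ∧
      ∀ d, ClosedColors n k m i d ↔ InWindow k (windowStart k m i) (n + 1) d) := by
  unfold ClosedColors
  by_cases h₁ : i < k
  · exact Or.inl ⟨h₁, fun d => by rw [if_pos h₁]⟩
  by_cases h₂ : ExceptionalClique k m i
  · exact Or.inr (Or.inl ⟨by omega, h₂, fun d => by rw [if_neg h₁, if_pos h₂]⟩)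
  · refine Or.inr (Or.inr ⟨by omega, h₂, ?_, fun d => by rw [if_neg h₁, if_neg h₂]⟩)
    unfold windowStart
    split_ifs <;> omega

theorem closedColors_of_lt {i : ℕ} (h : i < k) (d : ℕ) :
    ClosedColors n k m i d ↔ InWindow k i n d := by
  rw [ClosedColors, if_pos h]

theorem closedColors_of_le (n : ℕ) {i : ℕ} (hk : 4 ≤ k) (h : k ≤ i) (hi : i < m) :
    (i + 1 = m ∧ (m = k + 1 ∨ m + 1 = 2 * k) ∧
      ∀ d, ClosedColors n k m i d ↔ d + 1 < n ∨ d + 2 = k) ∨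
    ((i + 1 = m ∧ m ≠ k + 1 ∧ m + 1 ≠ 2 * k ∨ i = k ∧ i + 1 < m ∧ m + 1 = 2 * k) ∧
      ∀ d, ClosedColors n k m i d ↔ InWindow k (k - 1) (n + 1) d) ∨
    (i + 1 < m ∧ (i ≠ k ∨ m + 1 ≠ 2 * k) ∧
      ∀ d, ClosedColors n k m i d ↔ InWindow k (i - k) (n + 1) d) := by
  have hik : ¬ i < k := not_lt.2 h
  by_cases he : ExceptionalClique k m i
  · exact Or.inl ⟨he.1, he.2, fun d => by rw [ClosedColors, if_neg hik, if_pos he]⟩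
  have he' := he
  unfold ExceptionalClique at he'
  by_cases hw : i + 1 = m ∨ i = k ∧ m + 1 = 2 * k
  · exact Or.inr (Or.inl ⟨by omega, fun d => by
      rw [ClosedColors, if_neg hik, if_neg he, windowStart, if_pos hw]⟩)
  · exact Or.inr (Or.inr ⟨by omega, by omega, fun d => by
      rw [ClosedColors, if_neg hik, if_neg he, windowStart, if_neg hw]⟩)

-- The alternatives of `hcase` are k = n + 2 with m ≤ 2n + 2, and k = ⌈m/2⌉. For m > k they put the
-- colour m - 1 - k of the last core vertex into the window k - 1, 0, …, n - 1, except for m + 1 =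
-- 2k, where the exceptional set contains it.
variable (hn : 2 ≤ n) (hnk : n + 2 ≤ k) (hkm : k ≤ m) (hmk : m ≤ 2 * k)
  (hcase : k = n + 2 ∧ m ≤ k + n ∨ m + 1 = 2 * k ∨ m = 2 * k)

include hnk hmk in
theorem cliqueColor_lt {i : ℕ} (hi : i < m) {t : ℕ} (ht : t < n) : cliqueColor n k m i t < k := by
  unfold cliqueColor windowStart
  split_ifs <;> omega

include hn hnk hmk

theorem cliqueColor_injective {i : ℕ} (hi : i < m) {s t : ℕ} (hs : s < n) (ht : t < n)
    (h : cliqueColor n k m i s = cliqueColor n k m i t) : s = t := by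
  unfold cliqueColor at h
  have hw : k ≤ i → windowStart k m i < k := by
    intro hki
    unfold windowStart
    split_ifs <;> omega
  generalize windowStart k m i = w at h hw
  split_ifs at h <;> omega

theorem exists_cliqueColor_iff {i : ℕ} (hi : i < m) {d : ℕ} (hd : d < k) :
    (∃ t < n, cliqueColor n k m i t = d) ↔ CliqueColors n k m i d := by
  unfold CliqueColors
  rcases closedColors_cases n (by omega) hi hmk with ⟨h, hP⟩ | ⟨h, he, hP⟩ | ⟨h, he, hw, hP⟩
  · rw [hP]
    simp only [cliqueColor, if_pos h, InWindow]
    constructor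
    · rintro ⟨t, ht, rfl⟩
      split_ifs <;> omega
    · rintro ⟨hd' | hd', -⟩
      · exact ⟨d - i, by omega, by rw [if_pos (by omega)]; omega⟩
      · exact ⟨d + k - i, by omega, by rw [if_neg (by omega)]; omega⟩
  · rw [hP]
    simp only [cliqueColor, if_neg (not_lt.2 h), if_pos he]
    constructor
    · rintro ⟨t, ht, rfl⟩
      refine ⟨?_, fun _ h => absurd he h⟩
      split_ifs <;> omega
    · rintro ⟨hd' | hd', -⟩
      · exact ⟨d, by omega, by rw [if_pos (by omega)]⟩
      · exact ⟨n - 1, by omega, by rw [if_neg (by omega)]; omega⟩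
  · rw [hP]
    simp only [cliqueColor, if_neg (not_lt.2 h), if_neg he, InWindow]
    generalize windowStart k m i = w at hw
    constructor
    · rintro ⟨t, ht, rfl⟩
      refine ⟨?_, fun _ _ => ?_⟩ <;> split_ifs <;> omega
    · rintro ⟨hd', hne⟩
      have hne := hne h he
      by_cases hdw : d = w
      · exact ⟨0, by omega, by rw [if_pos rfl, hdw]⟩
      rcases hd' with hd' | hd'
      · refine ⟨d - w - 1, ?_, ?_⟩
        · omega
        · split_ifs at * <;> omega
      · refine ⟨d + k - w - 1, ?_, ?_⟩
        · omega
        · split_ifs at * <;> omega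

include hkm hcase in
theorem closedColors_iff {i : ℕ} (hi : i < m) {d : ℕ} (hd : d < k) :
    (coreColor k i = d ∨ coreColor k (cyclicSucc m i) = d ∨ CliqueColors n k m i d) ↔
      ClosedColors n k m i d := by
  suffices hends : ClosedColors n k m i (coreColor k i) ∧
      ClosedColors n k m i (coreColor k (cyclicSucc m i)) ∧
      (k ≤ i → ¬ ExceptionalClique k m i → coreColor k i =
        (if windowStart k m i + 1 = k then 0 else windowStart k m i + 1) ∨
        coreColor k (cyclicSucc m i) =
        (if windowStart k m i + 1 = k then 0 else windowStart k m i + 1)) by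
    constructor
    · rintro (rfl | rfl | h)
      · exact hends.1
      · exact hends.2.1
      · exact h.1
    · intro h
      by_cases h' : k ≤ i → ¬ ExceptionalClique k m i →
          d ≠ if windowStart k m i + 1 = k then 0 else windowStart k m i + 1
      · exact Or.inr (Or.inr ⟨h, h'⟩)
      · push Not at h'
        obtain ⟨h₁, h₂, h₃⟩ := h'
        rw [h₃]
        exact (hends.2.2 h₁ h₂).imp_right Or.inl
  rcases closedColors_cases n (by omega) hi hmk with ⟨h, hP⟩ | ⟨h, he, hP⟩ | ⟨h, he, hw, hP⟩
  · rw [hP, hP]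
    refine ⟨?_, ?_, by omega⟩ <;> unfold InWindow coreColor
    · split_ifs; omega
    · unfold cyclicSucc
      split_ifs <;> omega
  · rw [hP, hP]
    refine ⟨?_, ?_, fun _ h => absurd he h⟩ <;> unfold ExceptionalClique at he <;>
      unfold coreColor
    · split_ifs <;> omega
    · unfold cyclicSucc
      split_ifs <;> omega
  · rw [hP, hP]
    refine ⟨?_, ?_, fun _ _ => ?_⟩ <;> unfold ExceptionalClique at he <;>
      unfold coreColor
    · unfold InWindow windowStart
      split_ifs <;> omega
    · unfold InWindow windowStart cyclicSucc
      split_ifs <;> omega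
    · unfold windowStart cyclicSucc
      split_ifs <;> omega

theorem closedColors_injective {i j : ℕ} (hi : i < m) (hj : j < m)
    (h : ∀ d < k, ClosedColors n k m i d ↔ ClosedColors n k m j d) : i = j := by
  -- A window containing 0 but not k - 1 starts at 0 and, having length at least n, contains n - 1;
  -- the exceptional set does not.
  have hmixed : ∀ a l, a < k → 1 ≤ l → n ≤ l → l < k →
      ¬ ∀ d < k, (d + 1 < n ∨ d + 2 = k) ↔ InWindow k a l d := by
    intro a l ha hl hnl hlk h
    have h₁ := h 0 (by omega)
    have h₂ := h (k - 1) (by omega)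
    have h₃ := h (n - 1) (by omega)
    unfold InWindow at *
    omega
  rcases closedColors_cases n (by omega) hi hmk with ⟨h₁, hP⟩ | ⟨h₁, he, hP⟩ | ⟨h₁, he, hw, hP⟩ <;>
  rcases closedColors_cases n (by omega) hj hmk with
    ⟨h₁', hP'⟩ | ⟨h₁', he', hP'⟩ | ⟨h₁', he', hw', hP'⟩ <;>
  simp only [hP, hP'] at h
  · exact (window_eq h₁ h₁' (by omega) (by omega) (by omega) (by omega) h).1
  · exact absurd (fun d hd => (h d hd).symm) (hmixed i n h₁ (by omega) le_rfl (by omega))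
  · have := window_eq h₁ hw' (by omega) (by omega) (by omega) (by omega) h
    omega
  · exact absurd h (hmixed j n h₁' (by omega) le_rfl (by omega))
  · unfold ExceptionalClique at he he'
    omega
  · exact absurd h (hmixed _ (n + 1) hw' (by omega) (by omega) (by omega))
  · have := window_eq hw h₁' (by omega) (by omega) (by omega) (by omega) h
    omega
  · exact absurd (fun d hd => (h d hd).symm) (hmixed _ (n + 1) hw (by omega) (by omega) (by omega))
  · have := (window_eq hw hw' (by omega) (by omega) (by omega) (by omega) h).1
    unfold windowStart at this
    unfold ExceptionalClique at he he'
    split_ifs at this <;> omega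

include hkm hcase

theorem closedColors_core_aux {i j : ℕ} (hi : i < m) (hj : j < m)
    (hij : cyclicSucc m j = cyclicSucc m i + k) :
    ¬ ∀ d < k, ClosedColors n k m i d ∨ ClosedColors n k m (cyclicSucc m i) d ↔
      ClosedColors n k m j d ∨ ClosedColors n k m (cyclicSucc m j) d := by
  intro h
  by_cases hi' : i + 1 = m
  · have hs : cyclicSucc m i = 0 := by simp [cyclicSucc, hi']
    rw [hs] at hij h
    have hj' : j + 1 = k ∧ k < m := by
      unfold cyclicSucc at hij
      split_ifs at hij <;> omega
    rw [hij, zero_add] at h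
    -- Of the core vertices 0 and k only k sees the colour k - 1 if the last clique is exceptional,
    -- and only k sees n otherwise. For m = k + 1 an ordinary window on the last clique would make
    -- the two seen sets equal.
    have h₁ := h (k - 1) (by omega)
    have h₂ := h n (by omega)
    rcases closedColors_of_le n (by omega) (show k ≤ i by omega) hi with
      ⟨hi₁, hi₂, hP⟩ | ⟨hi₁, hP⟩ | ⟨hi₁, hi₂, hP⟩ <;>
    rcases closedColors_of_le n (by omega) le_rfl hj'.2 with
      ⟨hk₁, hk₂, hP'⟩ | ⟨hk₁, hP'⟩ | ⟨hk₁, hk₂, hP'⟩ <;>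
    simp only [hP, hP', closedColors_of_lt (show 0 < k by omega),
      closedColors_of_lt (show j < k by omega), InWindow] at h₁ h₂ <;> omega
  · have hs : cyclicSucc m i = i + 1 := by simp [cyclicSucc, hi']
    rw [hs] at hij h
    have hj' : j = i + k ∧ j + 1 < m := by
      unfold cyclicSucc at hij
      split_ifs at hij <;> omega
    -- This is the first colour after the window i, …, i + n seen by core vertex i + 1; core vertex
    -- i + 1 + k sees it.
    have h₁ := h (if i + 1 + n < k then i + 1 + n else i + 1 + n - k) (by split_ifs <;> omega)
    rw [hij] at h₁
    obtain ⟨rfl, hj'⟩ := hj'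
    have hd : (if i + 1 + n < k then i + 1 + n else i + 1 + n - k) = i + 1 + n ∨
        (if i + 1 + n < k then i + 1 + n else i + 1 + n - k) + k = i + 1 + n := by
      split_ifs <;> omega
    have hdk : (if i + 1 + n < k then i + 1 + n else i + 1 + n - k) < k := by
      split_ifs <;> omega
    generalize (if i + 1 + n < k then i + 1 + n else i + 1 + n - k) = d at h₁ hd hdk
    have hP := (closedColors_of_lt (m := m) (n := n) (show i < k by omega) d).not.2
      (by unfold InWindow; omega)
    have hP' := (closedColors_of_lt (m := m) (n := n) (show i + 1 < k by omega) d).not.2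
      (by unfold InWindow; omega)
    refine (not_or_intro hP hP') (h₁.2 (Or.inr ?_))
    rcases closedColors_of_le (m := m) n (by omega) (show k ≤ i + 1 + k by omega) (by omega) with
      ⟨hi₁, hi₂, hP⟩ | ⟨hi₁, hP⟩ | ⟨hi₁, hi₂, hP⟩ <;> simp only [hP, InWindow] <;> omega

theorem closedColors_core_injective {i j : ℕ} (hi : i < m) (hj : j < m)
    (hij : coreColor k (cyclicSucc m i) = coreColor k (cyclicSucc m j))
    (h : ∀ d < k, ClosedColors n k m i d ∨ ClosedColors n k m (cyclicSucc m i) d ↔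
      ClosedColors n k m j d ∨ ClosedColors n k m (cyclicSucc m j) d) : i = j := by
  have hcases : cyclicSucc m j = cyclicSucc m i + k ∨ cyclicSucc m i = cyclicSucc m j + k ∨
      i = j := by
    unfold coreColor cyclicSucc at hij
    unfold cyclicSucc
    split_ifs at * <;> omega
  rcases hcases with h' | h' | h'
  · exact absurd h (closedColors_core_aux hn hnk hkm hmk hcase hi hj h')
  · exact absurd (fun d hd => (h d hd).symm)
      (closedColors_core_aux hn hnk hkm hmk hcase hj hi h')
  · exact h'

omit hmk hcase hkm in
theorem not_window_subset_closedColors (hmk : m ≤ 2 * k) {a j : ℕ} (ha : a < k) (hj : j < m) :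
    ¬ ∀ d < k, InWindow k a (n + 2) d → ClosedColors n k m j d := by
  intro h
  rcases closedColors_cases n (by omega) hj hmk with ⟨h₁, hP⟩ | ⟨h₁, he, hP⟩ | ⟨h₁, he, hw, hP⟩ <;>
  simp only [hP] at h
  · have := window_le_of_subset ha h₁ (by omega) (by omega) h
    omega
  · have h₁ := h (k - 1) (by omega)
    have h₂ := h (n - 1) (by omega)
    have h₃ := h a ha
    have h₄ := h (if a + 1 < k then a + 1 else 0) (by split_ifs <;> omega)
    unfold InWindow at *
    split_ifs at * <;> omega
  · have := window_le_of_subset ha hw (by omega) (by omega) h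
    omega

theorem closedColors_mixed {i j : ℕ} (hi : i < m) (hj : j < m)
    (hM : CliqueColors n k m j (coreColor k (cyclicSucc m i))) :
    ¬ ∀ d < k, ClosedColors n k m i d ∨ ClosedColors n k m (cyclicSucc m i) d ↔
      ClosedColors n k m j d := by
  intro h
  by_cases hlast : i + 1 = m
  · have hs : cyclicSucc m i = 0 := by simp [cyclicSucc, hlast]
    rw [hs] at hM h
    obtain ⟨-, hM⟩ := hM
    by_cases he : ExceptionalClique k m i
    -- Core vertex 0 sees 0, …, n - 1 and k - 2. For k = n + 2 this is the window 0, …, n; for m + 1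
    -- = 2k, clique k therefore has its window moved to start at k - 1.
    · have h₁ := h 0 (by omega)
      have h₂ := h (k - 1) (by omega)
      have h₃ := h (k - 2) (by omega)
      have h₄ := h (n - 1) (by omega)
      rcases closedColors_of_le n (by omega) (show k ≤ i by unfold ExceptionalClique at he; omega)
        hi with ⟨hi₁, hi₂, hP⟩ | ⟨hi₁, hP⟩ | ⟨hi₁, hi₂, hP⟩
      · simp only [hP, closedColors_of_lt (show 0 < k by omega), InWindow] at h₁ h₂ h₃ h₄
        rcases lt_or_ge j k with hjk | hjk
        · simp only [closedColors_of_lt hjk, InWindow] at h₁ h₂ h₃ h₄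
          omega
        rcases closedColors_of_le n (by omega) hjk hj with
          ⟨hj₁, hj₂, hP'⟩ | ⟨hj₁, hP'⟩ | ⟨hj₁, hj₂, hP'⟩ <;>
        simp only [hP', InWindow] at h₁ h₂ h₃ h₄ <;> omega
      · unfold ExceptionalClique at he
        omega
      · omega
    -- Only a clique with window start k - 1 can match, and it omits the colour 0 of this core
    -- vertex.
    · have hT : ∀ d < k, InWindow k (k - 1) (n + 1) d ↔ ClosedColors n k m j d := by
        intro d hd
        rw [← h d hd, closedColors_of_lt (show 0 < k by omega)]
        rcases lt_or_ge i k with hik | hik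
        · rw [closedColors_of_lt hik]
          unfold InWindow
          omega
        unfold ExceptionalClique at he
        rcases closedColors_of_le n (by omega) hik hi with
          ⟨hi₁, hi₂, hP⟩ | ⟨hi₁, hP⟩ | ⟨hi₁, hi₂, hP⟩
        · omega
        · rw [hP]
          unfold InWindow
          omega
        · omega
      rcases closedColors_cases n (by omega) hj hmk with
        ⟨h₁, hP⟩ | ⟨h₁, he', hP⟩ | ⟨h₁, he', hw, hP⟩ <;> simp only [hP] at hT
      · have := window_eq (by omega) h₁ (by omega) (by omega) (by omega) (by omega) hT
        omega
      · unfold ExceptionalClique at he he'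
        omega
      · have := (window_eq (by omega) hw (by omega) (by omega) (by omega) (by omega) hT).1
        have hM := hM h₁ he'
        unfold coreColor at hM
        split_ifs at hM <;> omega
  have hs : cyclicSucc m i = i + 1 := by simp [cyclicSucc, hlast]
  rw [hs] at hM h
  obtain ⟨-, hM⟩ := hM
  by_cases hik : i + 1 < k
  -- Only a clique with window start i can match, and it omits the colour i + 1 of this core vertex.
  · have hT : ∀ d < k, InWindow k i (n + 1) d ↔ ClosedColors n k m j d := by
      intro d hd
      rw [← h d hd]
      unfold ClosedColors InWindow
      rw [if_pos (by omega), if_pos hik]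
      omega
    rcases closedColors_cases n (by omega) hj hmk with
      ⟨h₁, hP⟩ | ⟨h₁, he, hP⟩ | ⟨h₁, he, hw, hP⟩ <;> simp only [hP] at hT
    · have := window_eq (by omega) h₁ (by omega) (by omega) (by omega) (by omega) hT
      omega
    · have h₁ := hT 0 (by omega)
      have h₂ := hT (k - 1) (by omega)
      have h₃ := hT (n - 1) (by omega)
      unfold InWindow at *
      omega
    · have := (window_eq (by omega) hw (by omega) (by omega) (by omega) (by omega) hT).1
      have hM := hM h₁ he
      unfold coreColor at hM
      split_ifs at hM <;> omega
  by_cases hik' : i + 1 = k ∧ (m = k + 1 ∨ m + 1 = 2 * k)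
  · obtain ⟨rfl, hm | hm⟩ := hik'
    -- Here m = k + 1 forces k = n + 2, so the seen colours k - 2, k - 1, 0, …, n - 2 form a window
    -- starting at n.
    · have hT : ∀ d < i + 1, InWindow (i + 1) n (n + 1) d ↔ ClosedColors n (i + 1) m j d := by
        intro d hd
        rw [← h d hd, closedColors_of_lt (show i < i + 1 by omega)]
        rcases closedColors_of_le n (by omega) (le_refl (i + 1)) (show i + 1 < m by omega) with
          ⟨hi₁, hi₂, hP⟩ | ⟨hi₁, hP⟩ | ⟨hi₁, hi₂, hP⟩
        · rw [hP]
          unfold InWindow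
          omega
        · omega
        · omega
      rcases lt_or_ge j (i + 1) with hjk | hjk
      · simp only [closedColors_of_lt hjk] at hT
        have := window_eq (by omega) hjk (by omega) (by omega) (by omega) (by omega) hT
        omega
      · have h₁ := hT i (by omega)
        rcases closedColors_of_le n (by omega) hjk hj with
          ⟨hj₁, hj₂, hP⟩ | ⟨hj₁, hP⟩ | ⟨hj₁, hj₂, hP⟩
        · rw [hP] at h₁
          unfold InWindow at h₁
          omega
        · omega
        · omega
    · have hT : ∀ d < i + 1, InWindow (i + 1) i (n + 1) d ↔ ClosedColors n (i + 1) m j d := by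
        intro d hd
        rw [← h d hd]
        rw [closedColors_of_lt (show i < i + 1 by omega)]
        rcases closedColors_of_le n (by omega) (le_refl (i + 1)) (show i + 1 < m by omega) with
          ⟨hi₁, hi₂, hP⟩ | ⟨hi₁, hP⟩ | ⟨hi₁, hi₂, hP⟩
        · omega
        · rw [hP]
          unfold InWindow
          omega
        · omega
      rcases closedColors_cases n (by omega) hj hmk with
        ⟨h₁, hP⟩ | ⟨h₁, he, hP⟩ | ⟨h₁, he, hw, hP⟩ <;> simp only [hP] at hT
      · have := window_eq (by omega) h₁ (by omega) (by omega) (by omega) (by omega) hT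
        omega
      · have h₁ := hT i (by omega)
        unfold InWindow at *
        omega
      · have := (window_eq (by omega) hw (by omega) (by omega) (by omega) (by omega) hT).1
        have hM := hM h₁ he
        unfold coreColor at hM
        split_ifs at hM <;> omega
  -- In the remaining cases the core vertex sees n + 2 consecutive colours, more than a clique
  -- vertex does.
  obtain ⟨a, ha, hT⟩ : ∃ a < k, ∀ d < k, InWindow k a (n + 2) d →
      ClosedColors n k m i d ∨ ClosedColors n k m (i + 1) d := by
    have hnext := closedColors_of_le n (by omega) (show k ≤ i + 1 by omega)
      (show i + 1 < m by omega)
    rcases lt_or_ge i k with hik₁ | hik₁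
    · refine ⟨k - 1, by omega, fun d hd => ?_⟩
      rw [closedColors_of_lt hik₁]
      rcases hnext with ⟨hj₁, hj₂, hP'⟩ | ⟨hj₁, hP'⟩ | ⟨hj₁, hj₂, hP'⟩ <;> rw [hP'] <;>
        unfold InWindow <;> omega
    rcases closedColors_of_le n (by omega) hik₁ hi with
      ⟨hi₁, hi₂, hP⟩ | ⟨hi₁, hP⟩ | ⟨hi₁, hi₂, hP⟩
    · omega
    · refine ⟨k - 1, by omega, fun d hd => ?_⟩
      rw [hP]
      rcases hnext with ⟨hj₁, hj₂, hP'⟩ | ⟨hj₁, hP'⟩ | ⟨hj₁, hj₂, hP'⟩ <;> rw [hP'] <;>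
        unfold InWindow <;> omega
    · refine ⟨i - k, by omega, fun d hd => ?_⟩
      rw [hP]
      rcases hnext with ⟨hj₁, hj₂, hP'⟩ | ⟨hj₁, hP'⟩ | ⟨hj₁, hj₂, hP'⟩ <;> rw [hP'] <;>
        unfold InWindow <;> omega
  exact not_window_subset_closedColors hn hnk hmk ha hj fun d hd hd' => (h d hd).1 (hT d hd hd')

end CliqueColors

/-! ### Exact values -/

section Main

variable {m n k : ℕ} [NeZero m]

/-- The colour missing at the clique `i` in the colouring with `n + 1` colours. -/
def missingColor (m i : ℕ) : ℕ := cyclicSucc m (cyclicSucc m i)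

/-- The core colours are all distinct. The missing colour i + 2 differs from the end colours i and i
+ 1, so clique i really does not see it; neighbouring cliques miss different colours, so core
vertices see everything. -/
theorem exists_coloring_add_one (hm : 3 ≤ m) (hmn : m ≤ n + 1) :
    ∃ c : Fin m ⊕ (Fin m × Fin n) → Fin (n + 1),
      IsLocatingRainbowColoring (cycleCorona m n) c := by
  have hsucc : ∀ i < m, cyclicSucc m i < m := by
    intro i hi
    unfold cyclicSucc
    split_ifs <;> omega
  have hmiss : ∀ i < m, missingColor m i < m := fun i hi => hsucc _ (hsucc i hi)
  have hmiss_inj : ∀ i < m, ∀ j < m, missingColor m i = missingColor m j → i = j := by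
    intro i hi j hj h
    unfold missingColor cyclicSucc at h
    split_ifs at h <;> omega
  have hcolor : ∀ i < m, coreColor (n + 1) i = i := by
    intro i hi
    rw [coreColor, if_pos (by omega)]
  refine exists_locating_coloring hm (by omega)
    (fun i t => if t < missingColor m i then t else t + 1)
    (fun i d => d ≠ missingColor m i) (fun i d => d ≠ missingColor m i) ?_ ?_ ?_ ?_ ?_ ?_ ?_
  · intro i hi t ht
    split_ifs <;> omega
  · intro i hi d hd
    have := hmiss i hi
    constructor
    · rintro ⟨t, ht, rfl⟩
      split_ifs <;> omega
    · intro hne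
      rcases lt_or_gt_of_ne hne with h | h
      · exact ⟨d, by omega, if_pos h⟩
      · exact ⟨d - 1, by omega, by rw [if_neg (by omega)]; omega⟩
  · intro i hi d hd
    rw [hcolor i hi, hcolor _ (hsucc i hi)]
    have h₁ : i ≠ missingColor m i := by
      unfold missingColor cyclicSucc
      split_ifs <;> omega
    have h₂ : cyclicSucc m i ≠ missingColor m i := by
      unfold missingColor cyclicSucc
      split_ifs <;> omega
    omega
  · intro i hi s hs t ht h
    split_ifs at h <;> omega
  · intro i hi j hj d _ _ _ h
    have := hmiss i hi
    have := h (missingColor m i) (by omega)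
    exact hmiss_inj i hi j hj (by tauto)
  · intro i hi j hj h _
    rw [hcolor _ (hsucc i hi), hcolor _ (hsucc j hj)] at h
    unfold cyclicSucc at h
    split_ifs at h <;> omega
  · intro i hi j hj _ h
    have := hmiss j hj
    have h := h (missingColor m j) (by omega)
    have hne : i ≠ cyclicSucc m i := by
      unfold cyclicSucc
      split_ifs <;> omega
    refine hne ?_
    have h₁ : missingColor m j = missingColor m i := by tauto
    have h₂ : missingColor m j = missingColor m (cyclicSucc m i) := by tauto
    exact hmiss_inj _ hi _ (hsucc i hi) (h₁.symm.trans h₂)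

theorem exists_coloring_of_add_two_le (hm : 3 ≤ m) (hn : 2 ≤ n) (hnk : n + 2 ≤ k) (hkm : k ≤ m)
    (hmk : m ≤ 2 * k) (hcase : k = n + 2 ∧ m ≤ k + n ∨ m + 1 = 2 * k ∨ m = 2 * k) :
    ∃ c : Fin m ⊕ (Fin m × Fin n) → Fin k, IsLocatingRainbowColoring (cycleCorona m n) c :=
  exists_locating_coloring hm hmk (cliqueColor n k m) (CliqueColors n k m) (ClosedColors n k m)
    (fun _ hi _ ht => cliqueColor_lt hnk hmk hi ht)
    (fun _ hi _ hd => exists_cliqueColor_iff hn hnk hmk hi hd)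
    (fun _ hi _ hd => closedColors_iff hn hnk hkm hmk hcase hi hd)
    (fun _ hi _ hs _ ht h => cliqueColor_injective hn hnk hmk hi hs ht h)
    (fun _ hi _ hj _ _ _ _ h => closedColors_injective hn hnk hmk hi hj h)
    (fun _ hi _ hj h h' => closedColors_core_injective hn hnk hkm hmk hcase hi hj h h')
    (fun _ hi _ hj h => closedColors_mixed hn hnk hkm hmk hcase hi hj h)

theorem rvcl_cycleCorona_eq_add_one (hm : 3 ≤ m) (hmn : m ≤ n + 1) :
    rvcl (cycleCorona m n) = n + 1 :=
  rvcl_eq_of (by omega) (exists_coloring_add_one hm hmn) fun _ _ hc =>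
    add_one_le_of_locating hm (by omega) hc

theorem rvcl_cycleCorona_eq_add_two (hn : 2 ≤ n) (hnm : n + 2 ≤ m) (hmn : m ≤ 2 * n + 2) :
    rvcl (cycleCorona m n) = n + 2 :=
  rvcl_eq_of (by omega)
    (exists_coloring_of_add_two_le (by omega) hn le_rfl hnm (by omega)
      (Or.inl ⟨rfl, by omega⟩))
    fun _ _ hc => add_two_le_of_locating hn hnm hc

theorem rvcl_cycleCorona_eq_half (hn : 2 ≤ n) (hmn : n + 2 ≤ (m + 1) / 2) :
    rvcl (cycleCorona m n) = (m + 1) / 2 := by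
  refine rvcl_eq_of (by omega)
    (exists_coloring_of_add_two_le (by omega) hn hmn (by omega) (by omega) (by omega))
    fun k c hc => ?_
  have := le_two_mul_of_rainbow (by omega) (by omega) hc.1
  omega

end Main

theorem natCeil_half (m : ℕ) : ⌈(m : ℚ) / 2⌉₊ = (m + 1) / 2 := by
  apply le_antisymm
  · rw [Nat.ceil_le, div_le_iff₀ (by norm_num)]
    exact_mod_cast (by omega : m ≤ (m + 1) / 2 * 2)
  · have h := (div_le_iff₀ (by norm_num : (0 : ℚ) < 2)).1 (Nat.le_ceil ((m : ℚ) / 2))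
    have : m ≤ ⌈(m : ℚ) / 2⌉₊ * 2 := by exact_mod_cast h
    omega

theorem mainTheorem2 (m n : ℕ) (hm : 3 ≤ m) (hn : 2 ≤ n) :
    ((m = 3 ∨ (4 ≤ m ∧ m - 1 ≤ n)) →
      rvcl (edgeCorona (SimpleGraph.cycleGraph m) (SimpleGraph.completeGraph (Fin n))) = n + 1) ∧
    ((4 ≤ m ∧ ⌈(m : ℚ) / 2⌉₊ - 1 ≤ n ∧ n < m - 1) →
      rvcl (edgeCorona (SimpleGraph.cycleGraph m) (SimpleGraph.completeGraph (Fin n))) =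
        max (⌈(m : ℚ) / 2⌉₊ + 1) (n + 2)) ∧
    ((5 ≤ m ∧ n ≤ ⌈(m : ℚ) / 2⌉₊ - 2) →
      rvcl (edgeCorona (SimpleGraph.cycleGraph m) (SimpleGraph.completeGraph (Fin n))) = ⌈(m : ℚ) / 2⌉₊) := by
  have : NeZero m := ⟨by omega⟩
  obtain ⟨f⟩ := exists_iso_cycleCorona (m := m) (n := n) hm
  rw [← rvcl_congr f, natCeil_half]
  refine ⟨fun h => ?_, fun h => ?_, fun h => ?_⟩
  · exact rvcl_cycleCorona_eq_add_one hm (by omega)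
  -- In this range ⌈m/2⌉ + 1 ≤ n + 2, so the maximum is always its second term.
  · rw [rvcl_cycleCorona_eq_add_two hn (by omega) (by omega), max_eq_right (by omega)]
  · exact rvcl_cycleCorona_eq_half hn (by omega)
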